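/- Let $F$ be a biholomorphism between two open neighbourhoods of the origin of $\mathbb{C}^2$, with $F(0)=0$, which near the origin has one of the following two forms, where $A,B$ are germs of holomorphic functions at $0$ and $\operatorname{ord}$ denotes the order of the power series at $0$: (1) $F(x,y)=\left(x+x^{M+1}[a+A(x,y)],\; y+x^{M}[cx+by+B(x,y)]\right)$, with $M\ge 1$, $a,b,c\in\mathbb{C}$, $ab\ne 0$, $\operatorname{ord}A\ge 1$, $\operatorname{ord}B\ge 2$; (3) $F(x,y)=\left(x+x^{M+1}y^{N}[a+A(x,y)],\; y+x^{M}y^{N+1}[b+B(x,y)]\right)$, with $M,N\ge 1$, $a,b\in\mathbb{C}$, $ab\ne 0$, $\operatorname{ord}A,\operatorname{ord}B\ge 1$. In case (1) assume $\operatorname{Re}(b/a)<0$; in case (3) assume $aM+bN\neq0$ and that $\operatorname{Re}\left(\frac{a}{aM+bN}\right)<0$ or $\operatorname{Re}\left(\frac{b}{aM+bN}\right)<0$. Then there exist an open neighbourhood $\mathcal{U}$ of the origin, contained in the domains of $F$ and of $F^{-1}$, in which the fixed set of $F$ is $\{x=0\}$ in case (1) and $\{xy=0\}$ in case (3), and sets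 $\mathcal{P}^+,\mathcal{P}^-\subset\mathcal{U}$, which are nonempty one-dimensional complex submanifolds of $\mathcal{U}$ in case (1) and are empty in case (3), such that: for every $p\in\mathcal{U}\setminus\mathcal{P}^+$ outside the fixed set there exists $j\in\mathbb{N}$ with $F^{j}(p)\notin\mathcal{U}$; and for every $p\in\mathcal{U}\setminus\mathcal{P}^-$ outside the fixed set there exists $j\in\mathbb{N}$ with $F^{-j}(p)\notin\mathcal{U}$. In case (1), $\mathcal{P}^+$ (resp. $\mathcal{P}^-$) is the set of points of $\mathcal{U}$ that are attracted under $F$ (resp. $F^{-1}$) to the parabolic curves of $F$ (resp. $F^{-1}$), that is, the points whose forward orbit under $F$ (resp. $F^{-1}$) stays in $\mathcal{U}$ and eventually enters a parabolic curve of $F$ (resp. $F^{-1}$). Here a parabolic curve of a map $G$ fixing $0$ is a set $\varphi(\Delta)$ contained in the domain of $G$, where $\Delta\subset\mathbb{C}$ is a simply connected domain with $0\in\partial\Delta$ and $\varphi:\Delta\to\mathbb{C}^2\setminus\{0\}$ is an injective holomorphic map with $\varphi(\zeta)\to 0$ as $\zeta\to 0$, such that $G(\varphi(\Delta))\subset\varphi(\Delta)$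 and $G^{j}\circ\varphi\to 0$ as $j\to\infty$ uniformly on compact subsets of $\Delta$. -/

import Mathlib

open Filter Topology Set

namespace SaddleDynamics

/-- A biholomorphism fixing the origin of `ℂ²`, given by a representative: `F` is a biholomorphic
map from the open set `F.source`, which contains `0`, onto the open set `F.target`. -/
def IsBiholomorphismAtZero (F : OpenPartialHomeomorph (ℂ × ℂ) (ℂ × ℂ)) : Prop :=
  (0 : ℂ × ℂ) ∈ F.source ∧ F 0 = 0 ∧
    AnalyticOnNhd ℂ F F.source ∧ AnalyticOnNhd ℂ F.symm F.target

/-- `f` is a germ of holomorphic function at `0 ∈ ℂ²` whose power series has order at least `k`,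
that is, has no term of total degree less than `k`. -/
def OrdAtLeast (k : ℕ) (f : ℂ × ℂ → ℂ) : Prop :=
  AnalyticAt ℂ f 0 ∧ f =O[𝓝 0] fun p => ‖p‖ ^ k

/-- `F(x,y) = (x + x^(M+1) [a + A(x,y)], y + x^M [c x + b y + B(x,y)])` near the origin, with
`M ≥ 1`, `a b ≠ 0`, `ord A ≥ 1` and `ord B ≥ 2`. -/
def IsNonCornerForm (F : ℂ × ℂ → ℂ × ℂ) (M : ℕ) (a b c : ℂ) : Prop :=
  1 ≤ M ∧ a * b ≠ 0 ∧ ∃ A B : ℂ × ℂ → ℂ, OrdAtLeast 1 A ∧ OrdAtLeast 2 B ∧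
    ∀ᶠ p in 𝓝 (0 : ℂ × ℂ), F p =
      (p.1 + p.1 ^ (M + 1) * (a + A p), p.2 + p.1 ^ M * (c * p.1 + b * p.2 + B p))

/-- `F(x,y) = (x + x^(M+1) y^N [a + A(x,y)], y + x^M y^(N+1) [b + B(x,y)])` near the origin, with
`M, N ≥ 1`, `a b ≠ 0`, `ord A ≥ 1` and `ord B ≥ 1`. -/
def IsCornerForm (F : ℂ × ℂ → ℂ × ℂ) (M N : ℕ) (a b : ℂ) : Prop :=
  1 ≤ M ∧ 1 ≤ N ∧ a * b ≠ 0 ∧ ∃ A B : ℂ × ℂ → ℂ, OrdAtLeast 1 A ∧ OrdAtLeast 1 B ∧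
    ∀ᶠ p in 𝓝 (0 : ℂ × ℂ), F p =
      (p.1 + p.1 ^ (M + 1) * p.2 ^ N * (a + A p), p.2 + p.1 ^ M * p.2 ^ (N + 1) * (b + B p))

/-- `S` is a parabolic curve of `F` (at the origin): the image of an injective holomorphic map
`φ : Δ → ℂ² \ {0}`, where `Δ ⊆ ℂ` is a simply connected domain with `0 ∈ ∂Δ`, `φ` extends
continuously to `0` by `φ(0) = 0`, `S = φ(Δ)` is invariant under `F`, and the iterates of `F`
converge to `0` on `S`, uniformly on compact subsets of `Δ`. -/
def IsParabolicCurve (F : OpenPartialHomeomorph (ℂ × ℂ) (ℂ × ℂ)) (S : Set (ℂ × ℂ)) : Prop :=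
  ∃ (Δ : Set ℂ) (φ : ℂ → ℂ × ℂ),
    IsOpen Δ ∧ IsSimplyConnected Δ ∧ (0 : ℂ) ∈ frontier Δ ∧
    AnalyticOnNhd ℂ φ Δ ∧ InjOn φ Δ ∧ (∀ ζ ∈ Δ, φ ζ ≠ 0) ∧ Tendsto φ (𝓝[Δ] 0) (𝓝 0) ∧
    S = φ '' Δ ∧ S ⊆ F.source ∧ MapsTo F S S ∧
    ∀ K ⊆ Δ, IsCompact K → TendstoUniformlyOn (fun (j : ℕ) ζ => F^[j] (φ ζ)) (fun _ => 0) atTop K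

/-- The points of `U` that are attracted by `F|_U` into the parabolic curves of `F`: those whose
forward orbit is contained in `U` and eventually enters a parabolic curve of `F`. -/
def attractedSet (F : OpenPartialHomeomorph (ℂ × ℂ) (ℂ × ℂ)) (U : Set (ℂ × ℂ)) : Set (ℂ × ℂ) :=
  {p | (∀ j : ℕ, F^[j] p ∈ U) ∧ ∃ S, IsParabolicCurve F S ∧ ∃ j : ℕ, F^[j] p ∈ S}

/-- `P` is a (nonempty, embedded) one-dimensional complex submanifold of the open set `U ⊆ ℂ²`:
near each of its points, it is the zero set of a holomorphic function without critical points. -/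
def IsOneDimSubmanifold (P U : Set (ℂ × ℂ)) : Prop :=
  P ⊆ U ∧ P.Nonempty ∧ ∀ p ∈ P, ∃ (W : Set (ℂ × ℂ)) (g : ℂ × ℂ → ℂ), IsOpen W ∧ p ∈ W ∧ W ⊆ U ∧
    AnalyticOnNhd ℂ g W ∧ (∀ q ∈ W, fderiv ℂ g q ≠ 0) ∧ P ∩ W = {q ∈ W | g q = 0}

end SaddleDynamics

/-! ### Harmonic growth, sectors and approximate translations -/

namespace SaddleDynamics

/-! Put `m = x^M y^N`, `s = aM + bN` in the corner case and `m = x^M`, `s = aM` otherwise. Near the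
origin one step of `F` translates `u = -1/(s m)` by almost 1 (`eventually_drift`). So an orbit off
the fixed set that never leaves a small ball has `u` eventually in any prescribed narrow sector
around the positive axis, with `|u|` growing at most linearly. A quantity multiplied at each step by
at least `1 + δ/|u|` is then unbounded, because the harmonic series diverges
(`unbounded_of_growth`).

Corner case: `x` is multiplied by `1 + m(a + A)`, and `a m = -(a/s)/u`. If `Re (a/s) < 0`, the
factor has modulus at least `1 + δ/|u|`, so `x` cannot stay bounded and the orbit escapes. The
alternative on `b` follows by exchanging the coordinates.

Non-corner case: over the petals, where `u` lies in the sector, `x` tends to 0 while `Re (b/a) < 0`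
makes `1 + b x^M` expand in `y`. This is a saddle, and an invariant graph `y = ψ(x)` is found as the
limit of a graph transform (`exists_invariant_graph`). The contraction rate degenerates as `x → 0`,
so the errors are controlled with weights based on `|x_n|^(-M) ≥ |x|^(-M) + n|a|/4`. The distance
from an orbit to the graph obeys the same harmonic growth, so a trapped orbit over a petal lies on
the graph (`snd_eq_of_forall_iterate_mem`). Each point of the graph is on a parabolic curve
(`exists_isParabolicCurve`). Hence, off `x = 0`, being trapped and being attracted are the same, and
pulling the graph back by iterates of `F` gives the submanifold structure.

The inverse map has the same normal form with all coefficients negated, which leaves the hypotheses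
on the ratios unchanged. -/

theorem unbounded_of_growth {t d : ℕ → ℝ} {S δ : ℝ} (hδ : 0 < δ) (hS : 0 ≤ S)
    (ht : ∀ n, 0 < t n) (htS : ∀ n, t (n + 1) ≤ t n + S) (hd : 0 < d 0)
    (hstep : ∀ n, d n * (1 + δ / t n) ≤ d (n + 1)) (C : ℝ) : ∃ n, C < d n := by
  set T := t 0 + S with hT
  have hTpos : 0 < T := by have := ht 0; positivity
  have htn : ∀ n : ℕ, t n ≤ T * (n + 1) := by
    intro n
    induction n with
    | zero => simp [hT, hS]
    | succ n ih =>
      have := htS n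
      have := ht 0
      push_cast
      nlinarith
  -- As `t n ≤ T (n + 1)` and `d` never drops below `d 0`, each increment is at least `d 0 * (δ / T)
  -- / (n + 1)`.
  have hdn : ∀ n : ℕ, d 0 + d 0 * (δ / T) * ∑ i ∈ Finset.range n, (1 / ((i : ℝ) + 1)) ≤ d n := by
    intro n
    induction n with
    | zero => simp
    | succ n ih =>
      have hs : 0 ≤ ∑ i ∈ Finset.range n, (1 / ((i : ℝ) + 1)) :=
        Finset.sum_nonneg fun i _ => by positivity
      have h0 : d 0 ≤ d n := by
        have : 0 ≤ d 0 * (δ / T) * ∑ i ∈ Finset.range n, (1 / ((i : ℝ) + 1)) := by positivity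
        linarith
      have h1 : δ / T * (1 / ((n : ℝ) + 1)) ≤ δ / t n := by
        rw [div_mul_div_comm, mul_one]
        exact div_le_div_of_nonneg_left hδ.le (ht n) (htn n)
      have h2 : d 0 * (δ / T * (1 / ((n : ℝ) + 1))) ≤ d n * (δ / t n) :=
        mul_le_mul h0 h1 (by positivity) (hd.le.trans h0)
      rw [Finset.sum_range_succ]
      have := hstep n
      nlinarith
  have hlim : Tendsto (fun n : ℕ => d 0 + d 0 * (δ / T) * ∑ i ∈ Finset.range n,
      (1 / ((i : ℝ) + 1))) atTop atTop :=
    tendsto_atTop_add_const_left _ _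
      (Real.tendsto_sum_range_one_div_nat_succ_atTop.const_mul_atTop (by positivity))
  obtain ⟨n, hn⟩ := (hlim.eventually_gt_atTop C).exists
  exact ⟨n, hn.trans_le (hdn n)⟩

/-- The open sector of half-angle `arctan k` around the positive real axis. -/
def sector (k : ℝ) : Set ℂ := {v | |v.im| < k * v.re}

theorem isOpen_sector (k : ℝ) : IsOpen (sector k) :=
  isOpen_lt (by fun_prop) (by fun_prop)

theorem convex_sector (k : ℝ) : Convex ℝ (sector k) := by
  intro v hv w hw s t hs ht hst
  simp only [sector, mem_ofPred_eq] at *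
  have h1 : (s • v + t • w).im = s * v.im + t * w.im := by simp
  have h2 : (s • v + t • w).re = s * v.re + t * w.re := by simp
  rw [h1, h2]
  have h3 := abs_add_le (s * v.im) (t * w.im)
  rw [abs_mul, abs_mul, abs_of_nonneg hs, abs_of_nonneg ht] at h3
  rcases hs.eq_or_lt with rfl | hs'
  · obtain rfl : t = 1 := by linarith
    linarith
  · nlinarith [mul_lt_mul_of_pos_left hv hs', mul_le_mul_of_nonneg_left hw.le ht]

theorem sector_mono {k l : ℝ} (hk : 0 < k) (hkl : k ≤ l) : sector k ⊆ sector l := by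
  intro v (hv : |v.im| < k * v.re)
  have : 0 < v.re := pos_of_mul_pos_right ((abs_nonneg _).trans_lt hv) hk.le
  exact hv.trans_le (by gcongr)

theorem re_pos_of_mem_sector {k : ℝ} (hk : 0 < k) {v : ℂ} (hv : v ∈ sector k) : 0 < v.re :=
  pos_of_mul_pos_right ((abs_nonneg _).trans_lt hv) hk.le

theorem ne_zero_of_mem_sector {k : ℝ} {v : ℂ} (hv : v ∈ sector k) : v ≠ 0 := by
  rintro rfl
  simp [sector] at hv

theorem norm_le_of_mem_sector {k : ℝ} {v : ℂ} (hv : v ∈ sector k) (hr : 0 < v.re) :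
    ‖v‖ ≤ (1 + k) * v.re := by
  have := Complex.norm_le_abs_re_add_abs_im v
  rw [abs_of_pos hr] at this
  have : |v.im| < k * v.re := hv
  linarith

/-- Inversion is conjugation followed by a positive scaling. This passes between a petal coordinate
and its inverse, which is the one that is translated. -/
theorem inv_mem_sector {k : ℝ} {v : ℂ} (hv : v ∈ sector k) : v⁻¹ ∈ sector k := by
  have h0 := ne_zero_of_mem_sector hv
  have hN : 0 < Complex.normSq v := Complex.normSq_pos.2 h0
  have : |v.im| < k * v.re := hv
  simp only [sector, mem_ofPred_eq, Complex.inv_im, Complex.inv_re, neg_div, abs_neg, abs_div,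
    abs_of_pos hN]
  rw [← mul_div_assoc]
  gcongr

/-- The sector is so narrow that `Im l * Im v` absorbs at most half of `Re l * Re v`, and `‖v‖ ≤ 2 *
Re v`. It turns a sign condition on a ratio of coefficients into expansion. -/
theorem re_mul_ge_of_mem_sector {k : ℝ} (hk : 0 < k) (hk1 : k ≤ 1) {l : ℂ} (hl : 0 < l.re)
    (hkl : k * |l.im| ≤ l.re / 2) {v : ℂ} (hv : v ∈ sector k) :
    l.re / 4 * ‖v‖ ≤ (l * v).re := by
  have hr := re_pos_of_mem_sector hk hv
  have hn := norm_le_of_mem_sector hv hr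
  have hi : |v.im| < k * v.re := hv
  have h1 : l.im * v.im ≤ |l.im| * |v.im| := by rw [← abs_mul]; exact le_abs_self _
  have h2 : |l.im| * |v.im| ≤ |l.im| * (k * v.re) := by gcongr
  have h3 : (1 + k) * v.re ≤ 2 * v.re := by gcongr; linarith
  rw [Complex.mul_re]
  nlinarith

theorem exists_sector_width (l : ℂ) (hl : 0 < l.re) :
    ∃ k : ℝ, 0 < k ∧ k ≤ 1 / 4 ∧ k * |l.im| ≤ l.re / 2 := by
  refine ⟨min (1 / 4) (l.re / 2 / (|l.im| + 1)), by positivity, min_le_left _ _, ?_⟩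
  calc _ ≤ (l.re / 2 / (|l.im| + 1)) * |l.im| := by gcongr; exact min_le_right _ _
    _ ≤ (l.re / 2 / (|l.im| + 1)) * (|l.im| + 1) := by gcongr; linarith
    _ = _ := by field_simp

/-- A sequence with drift close to `1` ends up in every sector around the positive real axis. -/
theorem eventually_mem_sector_of_drift {u : ℕ → ℂ} {ε k : ℝ} (hε : ε < k * (1 - ε))
    (hk : 0 < k) (hε1 : ε < 1) (hu : ∀ n, ‖u (n + 1) - u n - 1‖ ≤ ε) (R : ℝ) :
    ∀ᶠ n in atTop, u n ∈ sector k ∧ R < (u n).re := by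
  have hre : ∀ n : ℕ, (u 0).re + n * (1 - ε) ≤ (u n).re := by
    intro n
    induction n with
    | zero => simp
    | succ n ih =>
      have := (abs_le.1 ((Complex.abs_re_le_norm _).trans (hu n))).1
      simp only [Complex.sub_re, Complex.one_re] at this
      push_cast
      linarith
  have him : ∀ n : ℕ, |(u n).im| ≤ |(u 0).im| + n * ε := by
    intro n
    induction n with
    | zero => simp
    | succ n ih =>
      have := (Complex.abs_im_le_norm _).trans (hu n)
      simp only [Complex.sub_im, Complex.one_im, sub_zero] at this
      have h2 := abs_sub_abs_le_abs_sub (u (n + 1)).im (u n).im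
      push_cast
      linarith
  have l1 : Tendsto (fun n : ℕ => (u 0).re + n * (1 - ε)) atTop atTop :=
    tendsto_atTop_add_const_left _ _ (tendsto_natCast_atTop_atTop.atTop_mul_const (by linarith))
  have l2 : Tendsto (fun n : ℕ => (k * (u 0).re - |(u 0).im|) + n * (k * (1 - ε) - ε)) atTop atTop :=
    tendsto_atTop_add_const_left _ _ (tendsto_natCast_atTop_atTop.atTop_mul_const (by linarith))
  filter_upwards [l1.eventually_gt_atTop R, l2.eventually_gt_atTop 0] with n h1 h2
  refine ⟨?_, h1.trans_le (hre n)⟩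
  change |(u n).im| < k * (u n).re
  have := him n
  have := mul_le_mul_of_nonneg_left (hre n) hk.le
  nlinarith

theorem mem_sector_of_drift {u u' : ℂ} {ε k : ℝ} (hε : ε < k * (1 - ε)) (hk : 0 < k)
    (hu : ‖u' - u - 1‖ ≤ ε) (h : u ∈ sector k) : u' ∈ sector k := by
  have h1 := (abs_le.1 ((Complex.abs_re_le_norm _).trans hu)).1
  have h2 := (Complex.abs_im_le_norm _).trans hu
  simp only [Complex.sub_re, Complex.one_re, Complex.sub_im, Complex.one_im, sub_zero] at h1 h2
  have h3 := abs_sub_abs_le_abs_sub u'.im u.im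
  have h4 : |u.im| < k * u.re := h
  change |u'.im| < k * u'.re
  nlinarith

theorem mul_mem_sector {k ε : ℝ} (hk : 0 < k) {v e : ℂ} (hv : v ∈ sector k) (he : ‖e‖ ≤ ε)
    (hε : ε * ((1 + k) * (1 + 2 * k)) ≤ k) : v * (1 + e) ∈ sector (2 * k) := by
  have hr := re_pos_of_mem_sector hk hv
  have hn := norm_le_of_mem_sector hv hr
  have hi : |v.im| < k * v.re := hv
  have hve : ‖v * e‖ ≤ (1 + k) * v.re * ε := by
    rw [norm_mul]; gcongr
  have h1 := (abs_le.1 ((Complex.abs_re_le_norm _).trans hve)).1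
  have h2 := (Complex.abs_im_le_norm _).trans hve
  have h3 := abs_add_le v.im (v * e).im
  change |(v * (1 + e)).im| < 2 * k * (v * (1 + e)).re
  rw [mul_add, mul_one, Complex.add_im, Complex.add_re]
  nlinarith

/-- Along `x ↦ x(1+mα)`, `y ↦ y(1+mβ)`, where `m = x^M y^N`, the quantity
`-1/((aM+bN)m)` is translated by almost `1`. -/
theorem eventually_drift (M N : ℕ) (a b : ℂ) (hs : a * M + b * N ≠ 0) {ε : ℝ} (hε : 0 < ε) :
    ∀ᶠ q in 𝓝 ((0 : ℂ), a, b), 1 + q.1 * q.2.1 ≠ 0 ∧ 1 + q.1 * q.2.2 ≠ 0 ∧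
      (q.1 ≠ 0 →
        ‖-((a * M + b * N) * (q.1 * ((1 + q.1 * q.2.1) ^ M * (1 + q.1 * q.2.2) ^ N)))⁻¹
          - -((a * M + b * N) * q.1)⁻¹ - 1‖ ≤ ε) := by
  set s := a * M + b * N with hsdef
  -- The geometric sum `Q n z` is `((1 + z) ^ n - 1) / z` continued to `z = 0`. The displacement
  -- becomes `R / (s * P)`, which is continuous at `m = 0` with value 1 there.
  let Q : ℕ → ℂ → ℂ := fun n z => ∑ i ∈ Finset.range n, (1 + z) ^ i
  have hQ : ∀ n z, (1 + z) ^ n = 1 + z * Q n z := by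
    intro n z
    have := mul_geom_sum (1 + z) n
    simp only [Q]
    rw [add_sub_cancel_left] at this
    rw [this]; ring
  have hQc : ∀ n, Continuous (Q n) := fun n => by fun_prop
  have hQ0 : ∀ n, Q n 0 = n := fun n => by simp [Q]
  let R : ℂ × ℂ × ℂ → ℂ := fun q => q.2.1 * Q M (q.1 * q.2.1) + q.2.2 * Q N (q.1 * q.2.2)
    + q.1 * q.2.1 * q.2.2 * Q M (q.1 * q.2.1) * Q N (q.1 * q.2.2)
  let P : ℂ × ℂ × ℂ → ℂ := fun q => (1 + q.1 * q.2.1) ^ M * (1 + q.1 * q.2.2) ^ N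
  have hRc : Continuous R := by
    have h1 := (hQc M).comp (f := fun q : ℂ × ℂ × ℂ => q.1 * q.2.1) (by fun_prop)
    have h2 := (hQc N).comp (f := fun q : ℂ × ℂ × ℂ => q.1 * q.2.2) (by fun_prop)
    simp only [Function.comp_def] at h1 h2
    fun_prop
  have hPc : Continuous P := by fun_prop
  have hR0 : R (0, a, b) = s := by simp [R, hQ0, hsdef]
  have hP0 : P (0, a, b) = 1 := by simp [P]
  have hPR : ∀ q, P q = 1 + q.1 * R q := by
    intro q
    simp only [P, R, hQ]
    ring
  have hlim : Tendsto (fun q => R q / (s * P q) - 1) (𝓝 ((0 : ℂ), a, b)) (𝓝 0) := by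
    have : ContinuousAt (fun q => R q / (s * P q) - 1) ((0 : ℂ), a, b) :=
      (hRc.continuousAt.div (continuousAt_const.mul hPc.continuousAt) (by rw [Pi.mul_apply, hP0, mul_one]; exact hs)).sub
        continuousAt_const
    simpa [ContinuousAt, hR0, hP0, hs] using this
  have e1 : ∀ᶠ q in 𝓝 ((0 : ℂ), a, b), 1 + q.1 * q.2.1 ≠ 0 := by
    have : ContinuousAt (fun q : ℂ × ℂ × ℂ => 1 + q.1 * q.2.1) ((0 : ℂ), a, b) := by fun_prop
    exact this.eventually_ne (by simp)
  have e2 : ∀ᶠ q in 𝓝 ((0 : ℂ), a, b), 1 + q.1 * q.2.2 ≠ 0 := by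
    have : ContinuousAt (fun q : ℂ × ℂ × ℂ => 1 + q.1 * q.2.2) ((0 : ℂ), a, b) := by fun_prop
    exact this.eventually_ne (by simp)
  filter_upwards [e1, e2, hlim.norm.eventually_le_const (by simpa using hε)] with q h1 h2 h3
  refine ⟨h1, h2, fun h0 => ?_⟩
  have hPq : P q ≠ 0 := mul_ne_zero (pow_ne_zero _ h1) (pow_ne_zero _ h2)
  refine le_of_eq_of_le (congrArg norm ?_) h3
  change -(s * (q.1 * P q))⁻¹ - -(s * q.1)⁻¹ - 1 = R q / (s * P q) - 1
  have := hPR q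
  field_simp
  rw [this]; ring

/-! ### Orders of vanishing and the normal form of the inverse map -/

theorem OrdAtLeast.map_zero {k : ℕ} (hk : 1 ≤ k) {f : ℂ × ℂ → ℂ} (hf : OrdAtLeast k f) :
    f 0 = 0 := by
  obtain ⟨C, hC⟩ := hf.2.bound
  have := hC.self_of_nhds
  simpa [Nat.one_le_iff_ne_zero.1 hk] using this

theorem ordAtLeast_one_iff {f : ℂ × ℂ → ℂ} :
    OrdAtLeast 1 f ↔ AnalyticAt ℂ f 0 ∧ f 0 = 0 := by
  refine ⟨fun h => ⟨h.1, h.map_zero le_rfl⟩, fun h => ⟨h.1, ?_⟩⟩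
  have := h.1.differentiableAt.isBigO_sub
  simpa [h.2] using this.norm_right

theorem OrdAtLeast.hasStrictFDerivAt {f : ℂ × ℂ → ℂ} (hf : OrdAtLeast 2 f) :
    HasStrictFDerivAt f (0 : ℂ × ℂ →L[ℂ] ℂ) 0 := by
  have h0 := hf.map_zero one_le_two
  have h1 : HasFDerivAt f (0 : ℂ × ℂ →L[ℂ] ℂ) 0 := by
    rw [hasFDerivAt_iff_isLittleO_nhds_zero]
    simp only [zero_add, h0, sub_zero, zero_apply]
    refine hf.2.trans_isLittleO ?_
    have : (fun p : ℂ × ℂ => ‖p‖ ^ 2) =o[𝓝 0] fun p => ‖p‖ ^ 1 :=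
      (Asymptotics.isLittleO_pow_pow (𝕜 := ℝ) one_lt_two).comp_tendsto tendsto_norm_zero
    simp only [pow_one] at this
    exact this.of_norm_right
  have := hf.1.hasStrictFDerivAt
  rwa [h1.fderiv] at this

/-- Solves for the old coordinate `x` in terms of the new ones `x v`, `y w`. The bracket `a - α / (v
^ (M + 1) * w ^ N)` is the remainder in the normal form of the inverse; it vanishes at the origin,
where `α = a` and `v = w = 1`. -/
theorem eq_add_of_mul_unit {M N : ℕ} {x y v w α : ℂ} (a : ℂ) (hv : v ≠ 0) (hw : w ≠ 0)
    (h : v = 1 + x ^ M * y ^ N * α) :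
    x = x * v + (x * v) ^ (M + 1) * (y * w) ^ N * (-a + (a - α / (v ^ (M + 1) * w ^ N))) := by
  have : (x * v) ^ (M + 1) * (y * w) ^ N * (-a + (a - α / (v ^ (M + 1) * w ^ N)))
      = -(x ^ (M + 1) * y ^ N * α) := by
    rw [mul_pow, mul_pow]
    field_simp
    ring
  rw [this]
  linear_combination (-x) * h

section Inverse

variable {F : OpenPartialHomeomorph (ℂ × ℂ) (ℂ × ℂ)}

theorem IsBiholomorphismAtZero.symm (hF : IsBiholomorphismAtZero F) :
    IsBiholomorphismAtZero F.symm := by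
  obtain ⟨h0, h1, h2, h3⟩ := hF
  refine ⟨by simpa [h1] using F.map_source h0, ?_, h3, by simpa using h2⟩
  have := F.left_inv h0
  rwa [h1] at this

theorem IsBiholomorphismAtZero.analyticAt_symm (hF : IsBiholomorphismAtZero F) :
    AnalyticAt ℂ F.symm 0 := hF.symm.2.2.1 0 hF.symm.1

theorem IsBiholomorphismAtZero.tendsto_symm (hF : IsBiholomorphismAtZero F) :
    Tendsto F.symm (𝓝 0) (𝓝 0) := by
  have := hF.analyticAt_symm.continuousAt
  rwa [ContinuousAt, hF.symm.2.1] at this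

theorem IsCornerForm.symm (hF : IsBiholomorphismAtZero F) {M N : ℕ} {a b : ℂ}
    (h : IsCornerForm F M N a b) : IsCornerForm F.symm M N (-a) (-b) := by
  obtain ⟨hM, hN, hab, A, B, hA, hB, hform⟩ := h
  rw [ordAtLeast_one_iff] at hA hB
  have hS := hF.analyticAt_symm
  have hS0 : F.symm 0 = 0 := hF.symm.2.1
  have hA' : AnalyticAt ℂ (fun p => A (F.symm p)) 0 :=
    AnalyticAt.fun_comp (f := F.symm) (by rw [hS0]; exact hA.1) hS
  have hB' : AnalyticAt ℂ (fun p => B (F.symm p)) 0 :=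
    AnalyticAt.fun_comp (f := F.symm) (by rw [hS0]; exact hB.1) hS
  have hX : AnalyticAt ℂ (fun p => (F.symm p).1) 0 := analyticAt_fst.fun_comp hS
  have hY : AnalyticAt ℂ (fun p => (F.symm p).2) 0 := analyticAt_snd.fun_comp hS
  let V : ℂ × ℂ → ℂ := fun p => 1 + (F.symm p).1 ^ M * (F.symm p).2 ^ N * (a + A (F.symm p))
  let W : ℂ × ℂ → ℂ := fun p => 1 + (F.symm p).1 ^ M * (F.symm p).2 ^ N * (b + B (F.symm p))
  have hV : AnalyticAt ℂ V 0 :=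
    analyticAt_const.add (((hX.pow M).mul (hY.pow N)).mul (analyticAt_const.add hA'))
  have hW : AnalyticAt ℂ W 0 :=
    analyticAt_const.add (((hX.pow M).mul (hY.pow N)).mul (analyticAt_const.add hB'))
  have hV0 : V 0 = 1 := by simp [V, hS0]; omega
  have hW0 : W 0 = 1 := by simp [W, hS0]; omega
  have hVM : AnalyticAt ℂ (fun p => V p ^ (M + 1) * W p ^ N) 0 := (hV.pow _).mul (hW.pow _)
  have hWM : AnalyticAt ℂ (fun p => V p ^ M * W p ^ (N + 1)) 0 := (hV.pow _).mul (hW.pow _)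
  refine ⟨hM, hN, by simpa using hab,
    fun p => a - (a + A (F.symm p)) / (V p ^ (M + 1) * W p ^ N),
    fun p => b - (b + B (F.symm p)) / (V p ^ M * W p ^ (N + 1)), ?_, ?_, ?_⟩
  · rw [ordAtLeast_one_iff]
    refine ⟨analyticAt_const.sub ((analyticAt_const.add hA').div hVM (by simp [hV0, hW0])), ?_⟩
    simp [hV0, hW0, hS0, hA.2]
  · rw [ordAtLeast_one_iff]
    refine ⟨analyticAt_const.sub ((analyticAt_const.add hB').div hWM (by simp [hV0, hW0])), ?_⟩
    simp [hV0, hW0, hS0, hB.2]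
  · filter_upwards [hF.tendsto_symm.eventually hform, F.open_target.mem_nhds hF.symm.1,
      hV.continuousAt.eventually_ne (by simp [hV0] : V 0 ≠ 0),
      hW.continuousAt.eventually_ne (by simp [hW0] : W 0 ≠ 0)] with p h1 h2 h3 h4
    rw [F.right_inv h2] at h1
    have e1 : p.1 = (F.symm p).1 * V p := by
      rw [h1]; simp only [V, ← h1]; ring
    have e2 : p.2 = (F.symm p).2 * W p := by
      rw [h1]; simp only [W, ← h1]; ring
    have e3 : V p = 1 + (F.symm p).1 ^ M * (F.symm p).2 ^ N * (a + A (F.symm p)) := rfl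
    have e4 : W p = 1 + (F.symm p).1 ^ M * (F.symm p).2 ^ N * (b + B (F.symm p)) := rfl
    ext
    · simp only [e1, e2]
      exact eq_add_of_mul_unit a h3 h4 e3
    · simp only [e1, e2]
      have := eq_add_of_mul_unit (x := (F.symm p).2) (y := (F.symm p).1) (N := M) (M := N)
        (α := b + B (F.symm p)) b h4 h3 (e4.trans (by ring))
      rwa [mul_comm (_ ^ (N + 1)), mul_comm (W p ^ (N + 1))] at this

theorem IsNonCornerForm.symm (hF : IsBiholomorphismAtZero F) {M : ℕ} {a b c : ℂ}
    (h : IsNonCornerForm F M a b c) : IsNonCornerForm F.symm M (-a) (-b) (-c) := by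
  obtain ⟨hM, hab, A, B, hA, hB, hform⟩ := h
  rw [ordAtLeast_one_iff] at hA
  have hB0 := hB.map_zero one_le_two
  have hS := hF.analyticAt_symm
  have hS0 : F.symm 0 = 0 := hF.symm.2.1
  have hA' : AnalyticAt ℂ (fun p => A (F.symm p)) 0 :=
    AnalyticAt.fun_comp (f := F.symm) (by rw [hS0]; exact hA.1) hS
  have hB' : AnalyticAt ℂ (fun p => B (F.symm p)) 0 :=
    AnalyticAt.fun_comp (f := F.symm) (by rw [hS0]; exact hB.1) hS
  have hX : AnalyticAt ℂ (fun p => (F.symm p).1) 0 := analyticAt_fst.fun_comp hS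
  have hY : AnalyticAt ℂ (fun p => (F.symm p).2) 0 := analyticAt_snd.fun_comp hS
  let V : ℂ × ℂ → ℂ := fun p => 1 + (F.symm p).1 ^ M * (a + A (F.symm p))
  let L : ℂ × ℂ → ℂ := fun p => c * (F.symm p).1 + b * (F.symm p).2 + B (F.symm p)
  have hV : AnalyticAt ℂ V 0 :=
    analyticAt_const.add ((hX.pow M).mul (analyticAt_const.add hA'))
  have hL : AnalyticAt ℂ L 0 :=
    ((analyticAt_const.mul hX).add (analyticAt_const.mul hY)).add hB'
  have hV0 : V 0 = 1 := by simp [V, hS0]; omega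
  have hL0 : L 0 = 0 := by simp [L, hS0, hB0]
  have bigX : (fun p => (F.symm p).1) =O[𝓝 0] fun p : ℂ × ℂ => ‖p‖ := by
    have := hX.differentiableAt.isBigO_sub
    simpa [hS0] using this.norm_right
  have bigS : (fun p => F.symm p) =O[𝓝 0] fun p : ℂ × ℂ => ‖p‖ := by
    have := hS.differentiableAt.isBigO_sub
    simpa [hS0] using this.norm_right
  have bigL : L =O[𝓝 0] fun p : ℂ × ℂ => ‖p‖ := by
    have := hL.differentiableAt.isBigO_sub
    simpa [hL0] using this.norm_right
  have bigXM : (fun p => (F.symm p).1 ^ M) =O[𝓝 0] fun p : ℂ × ℂ => ‖p‖ := by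
    have h1 : AnalyticAt ℂ (fun p => (F.symm p).1 ^ M) 0 := hX.pow M
    have := h1.differentiableAt.isBigO_sub
    simpa [hS0, Nat.one_le_iff_ne_zero.1 hM] using this.norm_right
  have hVinv : AnalyticAt ℂ (fun p => (V p ^ M)⁻¹) 0 := (hV.pow M).inv (by simp [hV0])
  have bigV : (fun p => 1 - (V p ^ M)⁻¹) =O[𝓝 0] fun p : ℂ × ℂ => ‖p‖ := by
    have h1 : AnalyticAt ℂ (fun p => 1 - (V p ^ M)⁻¹) 0 := analyticAt_const.sub hVinv
    have := h1.differentiableAt.isBigO_sub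
    simpa [hV0] using this.norm_right
  have ev : ∀ᶠ p in 𝓝 (0 : ℂ × ℂ), p.1 = (F.symm p).1 * V p ∧
      p.2 = (F.symm p).2 + (F.symm p).1 ^ M * L p := by
    filter_upwards [hF.tendsto_symm.eventually hform, F.open_target.mem_nhds hF.symm.1] with p h1 h2
    rw [F.right_inv h2] at h1
    constructor
    · rw [h1]; simp only [V, ← h1]; ring
    · rw [h1]; simp only [L, ← h1]
  have bigA : (fun p => a + A (F.symm p)) =O[𝓝 0] fun _ : ℂ × ℂ => (1 : ℝ) :=
    (analyticAt_const.add hA').continuousAt.isBigO_one ℝ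
  refine ⟨hM, by simpa using hab, fun p => a - (a + A (F.symm p)) / V p ^ (M + 1),
    fun p => c * p.1 + b * p.2 - L p * (V p ^ M)⁻¹, ?_, ⟨?_, ?_⟩, ?_⟩
  · rw [ordAtLeast_one_iff]
    refine ⟨analyticAt_const.sub ((analyticAt_const.add hA').div (hV.pow _) (by simp [hV0])), ?_⟩
    simp [hV0, hS0, hA.2]
  · exact ((analyticAt_const.mul analyticAt_fst).add (analyticAt_const.mul analyticAt_snd)).sub
      (hL.mul hVinv)
  -- The new remainder is `L (1 - V^(-M)) + c (x - X) + b (y - Y) - B(X, Y)`, where `(X, Y)` is the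
  -- preimage of `(x, y)`; each summand has order at least 2.
  · have h1 : (fun p => L p * (1 - (V p ^ M)⁻¹)) =O[𝓝 0] fun p : ℂ × ℂ => ‖p‖ ^ 2 := by
      simpa [pow_two] using bigL.mul bigV
    have h2 : (fun p => B (F.symm p)) =O[𝓝 0] fun p : ℂ × ℂ => ‖p‖ ^ 2 :=
      (hB.2.comp_tendsto hF.tendsto_symm).trans (bigS.norm_left.pow 2)
    have h3 : (fun p => c * ((F.symm p).1 * (F.symm p).1 ^ M * (a + A (F.symm p)))
        + b * ((F.symm p).1 ^ M * L p)) =O[𝓝 0] fun p : ℂ × ℂ => ‖p‖ ^ 2 := by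
      have e1 := ((bigX.mul bigXM).mul bigA).const_mul_left c
      have e2 := (bigXM.mul bigL).const_mul_left b
      simp only [mul_one, ← pow_two] at e1 e2
      exact e1.add e2
    refine ((h1.add h3).sub h2).congr' ?_ EventuallyEq.rfl
    filter_upwards [ev] with p hp
    have e3 : V p = 1 + (F.symm p).1 ^ M * (a + A (F.symm p)) := rfl
    have e4 : L p = c * (F.symm p).1 + b * (F.symm p).2 + B (F.symm p) := rfl
    linear_combination (-c) * hp.1 - b * hp.2 - c * (F.symm p).1 * e3 + e4
  · filter_upwards [ev, hV.continuousAt.eventually_ne (by simp [hV0] : V 0 ≠ 0)] with p hp h3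
    have e3 : V p = 1 + (F.symm p).1 ^ M * (a + A (F.symm p)) := rfl
    ext
    · simp only [hp.1]
      simpa using eq_add_of_mul_unit (N := 0) (y := 1) (w := 1) a h3 one_ne_zero (by simpa using e3)
    · have : p.1 ^ M * (V p ^ M)⁻¹ = (F.symm p).1 ^ M := by
        rw [hp.1, mul_pow]; exact mul_inv_cancel_right₀ (pow_ne_zero _ h3) _
      simp only
      linear_combination (-1) * hp.2 + L p * this

end Inverse

/-! ### The corner case: orbits off the axes escape -/

/-- Once `-(s m)⁻¹` is in the sector, so is its inverse `v = -s m`, and `m a = l v` with `l = -(a /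
s)` of positive real part. Hence `‖1 + m (a + A)‖ ≥ 1 + (Re l / 8) ‖v‖`, while `‖v‖⁻¹` grows by at
most 2 per step. -/
theorem unbounded_of_drift {s a : ℂ} (hs : s ≠ 0) (hl : (a / s).re < 0) :
    ∃ ε : ℝ, 0 < ε ∧ ∀ x m A : ℕ → ℂ, (∀ n, x n ≠ 0) → (∀ n, m n ≠ 0) → (∀ n, ‖A n‖ ≤ ε) →
      (∀ n, x (n + 1) = x n * (1 + m n * (a + A n))) →
      (∀ n, ‖-(s * m (n + 1))⁻¹ - -(s * m n)⁻¹ - 1‖ ≤ ε) → ∀ C : ℝ, ∃ n, C < ‖x n‖ := by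
  have hl' : 0 < (-(a / s)).re := by simpa using hl
  obtain ⟨k, hk, hk4, hkl⟩ := exists_sector_width _ hl'
  set l := -(a / s) with hldef
  have hs' : 0 < ‖s‖ := norm_pos_iff.2 hs
  refine ⟨min (k / 4) (l.re / 8 * ‖s‖), by positivity, fun x m A hx hm hA hstep hu C => ?_⟩
  have hεk : min (k / 4) (l.re / 8 * ‖s‖) ≤ k / 4 := min_le_left _ _
  have hεl : min (k / 4) (l.re / 8 * ‖s‖) ≤ l.re / 8 * ‖s‖ := min_le_right _ _
  generalize min (k / 4) (l.re / 8 * ‖s‖) = ε at *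
  have hev := eventually_mem_sector_of_drift (u := fun n => -(s * m n)⁻¹) (ε := ε) (k := k)
    (by nlinarith) hk (by linarith) hu 0
  obtain ⟨n₀, hn₀⟩ := eventually_atTop.1 hev
  suffices ∃ n, C < ‖x (n₀ + n)‖ from this.imp' (fun n => n₀ + n) fun _ hn => hn
  refine unbounded_of_growth (t := fun n => ‖-(s * m (n₀ + n))⁻¹‖)
    (d := fun n => ‖x (n₀ + n)‖) (S := 2) (δ := l.re / 8) (by positivity) (by norm_num)
    (fun n => norm_pos_iff.2 (neg_ne_zero.2 (inv_ne_zero (mul_ne_zero hs (hm _)))))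
    (fun n => ?_) (norm_pos_iff.2 (hx _)) (fun n => ?_) C
  · have h1 := norm_sub_norm_le (-(s * m (n₀ + n + 1))⁻¹ - -(s * m (n₀ + n))⁻¹) 1
    have h2 := norm_sub_norm_le (-(s * m (n₀ + n + 1))⁻¹) (-(s * m (n₀ + n))⁻¹)
    have h3 := hu (n₀ + n)
    rw [norm_one] at h1
    change ‖-(s * m (n₀ + n + 1))⁻¹‖ ≤ _
    linarith
  · have hv := inv_mem_sector (hn₀ (n₀ + n) (by omega)).1
    have hm' := hm (n₀ + n)
    rw [inv_neg, inv_inv] at hv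
    set v := -(s * m (n₀ + n)) with hvdef
    have hre := re_mul_ge_of_mem_sector hk (by linarith) hl' hkl hv
    have hma : m (n₀ + n) * a = l * v := by rw [hldef, hvdef]; field_simp
    have hnm : ‖v‖ = ‖s‖ * ‖m (n₀ + n)‖ := by rw [hvdef, norm_neg, norm_mul]
    have hmA : ‖m (n₀ + n) * A (n₀ + n)‖ ≤ l.re / 8 * ‖v‖ := by
      rw [norm_mul, hnm]
      have := (hA (n₀ + n)).trans hεl
      have h0 := norm_nonneg (m (n₀ + n))
      nlinarith
    have h1 : 1 + l.re / 8 * ‖v‖ ≤ ‖1 + m (n₀ + n) * (a + A (n₀ + n))‖ := by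
      refine le_trans ?_ (Complex.re_le_norm _)
      rw [mul_add, hma, Complex.add_re, Complex.one_re, Complex.add_re]
      have := (abs_le.1 ((Complex.abs_re_le_norm _).trans hmA)).1
      linarith
    change _ ≤ ‖x (n₀ + n + 1)‖
    rw [hstep, norm_mul]
    have hvi : ‖-(s * m (n₀ + n))⁻¹‖ = ‖v‖⁻¹ := by rw [hvdef]; simp
    simp only [hvi, div_inv_eq_mul]
    gcongr

theorem IsCornerForm.swap {F : ℂ × ℂ → ℂ × ℂ} {M N : ℕ} {a b : ℂ} (h : IsCornerForm F M N a b) :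
    IsCornerForm (fun p => (F p.swap).swap) N M b a := by
  obtain ⟨hM, hN, hab, A, B, hA, hB, hform⟩ := h
  have hsw : AnalyticAt ℂ (Prod.swap : ℂ × ℂ → ℂ × ℂ) 0 :=
    analyticAt_snd.prod analyticAt_fst
  have hsw0 : Tendsto (Prod.swap : ℂ × ℂ → ℂ × ℂ) (𝓝 0) (𝓝 0) := hsw.continuousAt
  have key : ∀ f, OrdAtLeast 1 f → OrdAtLeast 1 (fun p : ℂ × ℂ => f p.swap) := by
    intro f hf
    rw [ordAtLeast_one_iff] at hf ⊢
    exact ⟨AnalyticAt.fun_comp (f := Prod.swap) hf.1 hsw, hf.2⟩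
  refine ⟨hN, hM, by rwa [mul_comm], fun p => B p.swap, fun p => A p.swap, key B hB, key A hA, ?_⟩
  filter_upwards [hsw0.eventually hform] with p hp
  rw [hp]
  simp only [Prod.swap, Prod.mk.injEq]
  constructor <;> ring

theorem IsCornerForm.eventually_fixed_iff {F : ℂ × ℂ → ℂ × ℂ} {M N : ℕ} {a b : ℂ}
    (h : IsCornerForm F M N a b) : ∀ᶠ p in 𝓝 (0 : ℂ × ℂ), F p = p ↔ p.1 * p.2 = 0 := by
  obtain ⟨hM, hN, hab, A, B, hA, hB, hform⟩ := h
  rw [ordAtLeast_one_iff] at hA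
  have : ContinuousAt (fun p => a + A p) 0 := continuousAt_const.add hA.1.continuousAt
  filter_upwards [hform, this.eventually_ne (by simpa [hA.2] using left_ne_zero_of_mul hab)]
    with p hp h1
  rw [hp, Prod.ext_iff]
  have hM0 : M ≠ 0 := by omega
  have hN0 : N ≠ 0 := by omega
  constructor
  · rintro ⟨h2, -⟩
    simp_all
  · intro h2
    rcases mul_eq_zero.1 h2 with h2 | h2 <;> simp [h2, hM0, hN0]

/-- If `Re (a/(aM+bN)) < 0`, the first coordinate pushes every orbit outside the coordinate axes
out of any small polydisc. -/
theorem IsCornerForm.escape_fst {F : ℂ × ℂ → ℂ × ℂ} {M N : ℕ} {a b : ℂ}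
    (h : IsCornerForm F M N a b) (hre : (a / (a * M + b * N)).re < 0) :
    ∃ r₀ > 0, ∀ r ≤ r₀, ∀ p ∈ Metric.ball (0 : ℂ × ℂ) r, p.1 * p.2 ≠ 0 →
      ∃ j : ℕ, F^[j] p ∉ Metric.ball (0 : ℂ × ℂ) r := by
  obtain ⟨hM, hN, hab, A, B, hA, hB, hform⟩ := h
  rw [ordAtLeast_one_iff] at hA hB
  -- With the convention `a / 0 = 0`, the strict inequality excludes `aM + bN = 0`.
  have hs : a * M + b * N ≠ 0 := by
    intro h0
    simp [h0] at hre
  obtain ⟨ε, hε, hesc⟩ := unbounded_of_drift hs hre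
  have hM0 : M ≠ 0 := by omega
  have hq : Tendsto (fun p : ℂ × ℂ => (p.1 ^ M * p.2 ^ N, a + A p, b + B p)) (𝓝 0)
      (𝓝 (0, a, b)) := by
    have : ContinuousAt (fun p : ℂ × ℂ => (p.1 ^ M * p.2 ^ N, a + A p, b + B p)) 0 :=
      (by fun_prop : ContinuousAt (fun p : ℂ × ℂ => p.1 ^ M * p.2 ^ N) 0).prodMk
        ((continuousAt_const.add hA.1.continuousAt).prodMk
          (continuousAt_const.add hB.1.continuousAt))
    simpa [ContinuousAt, hA.2, hB.2, hM0] using this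
  have hAs : ∀ᶠ p in 𝓝 (0 : ℂ × ℂ), ‖A p‖ ≤ ε := by
    have := hA.1.continuousAt.norm
    exact this.eventually_le_const (by simpa [hA.2] using hε)
  obtain ⟨r₀, hr₀, hball⟩ := Metric.eventually_nhds_iff_ball.1
    (hform.and (hAs.and (hq.eventually (eventually_drift M N a b hs hε))))
  refine ⟨r₀, hr₀, fun r hr p hp hxy => ?_⟩
  by_contra! hstay
  have hstay' : ∀ j, F^[j] p ∈ Metric.ball (0 : ℂ × ℂ) r₀ :=
    fun j => Metric.ball_subset_ball hr (hstay j)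
  have hfac : ∀ j, F^[j + 1] p = ((F^[j] p).1 * (1 + (F^[j] p).1 ^ M * (F^[j] p).2 ^ N *
      (a + A (F^[j] p))), (F^[j] p).2 * (1 + (F^[j] p).1 ^ M * (F^[j] p).2 ^ N *
      (b + B (F^[j] p)))) := by
    intro j
    rw [Function.iterate_succ_apply', (hball _ (hstay' j)).1]
    ext <;> ring
  have hne : ∀ j, (F^[j] p).1 ≠ 0 ∧ (F^[j] p).2 ≠ 0 := by
    intro j
    induction j with
    | zero => exact mul_ne_zero_iff.1 hxy
    | succ j ih =>
      have := (hball _ (hstay' j)).2.2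
      rw [hfac]
      exact ⟨mul_ne_zero ih.1 this.1, mul_ne_zero ih.2 this.2.1⟩
  obtain ⟨n, hn⟩ := hesc (fun j => (F^[j] p).1) (fun j => (F^[j] p).1 ^ M * (F^[j] p).2 ^ N)
    (fun j => A (F^[j] p)) (fun j => (hne j).1)
    (fun j => mul_ne_zero (pow_ne_zero _ (hne j).1) (pow_ne_zero _ (hne j).2))
    (fun j => (hball _ (hstay' j)).2.1) (fun j => by rw [hfac])
    (fun j => by
      have := (hball _ (hstay' j)).2.2.2.2
        (mul_ne_zero (pow_ne_zero _ (hne j).1) (pow_ne_zero _ (hne j).2))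
      convert this using 7
      rw [hfac, mul_pow, mul_pow]
      ring) r₀
  have h1 : ‖(F^[n] p).1‖ ≤ ‖F^[n] p‖ := norm_fst_le _
  have h2 := mem_ball_zero_iff.1 (hstay' n)
  linarith

theorem IsCornerForm.escape {F : ℂ × ℂ → ℂ × ℂ} {M N : ℕ} {a b : ℂ}
    (h : IsCornerForm F M N a b)
    (hre : (a / (a * M + b * N)).re < 0 ∨ (b / (a * M + b * N)).re < 0) :
    ∃ r₀ > 0, ∀ r ≤ r₀, ∀ p ∈ Metric.ball (0 : ℂ × ℂ) r, p.1 * p.2 ≠ 0 →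
      ∃ j : ℕ, F^[j] p ∉ Metric.ball (0 : ℂ × ℂ) r := by
  rcases hre with hre | hre
  · exact h.escape_fst hre
  · rw [add_comm] at hre
    obtain ⟨r₀, hr₀, H⟩ := h.swap.escape_fst hre
    refine ⟨r₀, hr₀, fun r hr p hp hxy => ?_⟩
    have hsw : ∀ q : ℂ × ℂ, q.swap ∈ Metric.ball (0 : ℂ × ℂ) r ↔ q ∈ Metric.ball (0 : ℂ × ℂ) r := by
      intro q
      simp [Prod.norm_def, max_comm]
    obtain ⟨j, hj⟩ := H r hr p.swap ((hsw p).2 hp) (by simpa [mul_comm] using hxy)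
    refine ⟨j, ?_⟩
    have hsemi : Function.Semiconj Prod.swap F (fun p => (F p.swap).swap) := fun q => by simp
    rwa [← (hsemi.iterate_right j).eq, hsw] at hj

theorem exists_nhd_escape_of_isCornerForm {F : OpenPartialHomeomorph (ℂ × ℂ) (ℂ × ℂ)}
    (hF : IsBiholomorphismAtZero F) {M N : ℕ} {a b : ℂ} (h : IsCornerForm F M N a b)
    (hre : (a / (a * M + b * N)).re < 0 ∨ (b / (a * M + b * N)).re < 0) :
    ∃ U : Set (ℂ × ℂ), IsOpen U ∧ (0 : ℂ × ℂ) ∈ U ∧ U ⊆ F.source ∩ F.target ∧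
      (∀ p ∈ U, F p = p ↔ p.1 * p.2 = 0) ∧
      (∀ p ∈ U, F p ≠ p → ∃ j : ℕ, F^[j] p ∉ U) ∧
      (∀ p ∈ U, F p ≠ p → ∃ j : ℕ, F.symm^[j] p ∉ U) := by
  obtain ⟨r₁, hr₁, H₁⟩ := h.escape hre
  -- Passing to the inverse negates `a`, `b` and `aM + bN` together, so the ratios are unchanged.
  obtain ⟨r₂, hr₂, H₂⟩ := (h.symm hF).escape (by
    have e : -a * (M : ℂ) + -b * N = -(a * M + b * N) := by ring
    rwa [e, neg_div_neg_eq, neg_div_neg_eq])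
  obtain ⟨r₃, hr₃, H₃⟩ := Metric.eventually_nhds_iff_ball.1 (h.eventually_fixed_iff.and
    ((F.open_source.inter F.open_target).mem_nhds ⟨hF.1, hF.symm.1⟩))
  have hfix : ∀ p ∈ Metric.ball (0 : ℂ × ℂ) (min r₁ (min r₂ r₃)), F p = p ↔ p.1 * p.2 = 0 :=
    fun p hp => (H₃ p (Metric.ball_subset_ball (by simp) hp)).1
  refine ⟨Metric.ball 0 (min r₁ (min r₂ r₃)), Metric.isOpen_ball,
    Metric.mem_ball_self (by positivity),
    fun p hp => (H₃ p (Metric.ball_subset_ball (by simp) hp)).2, hfix, ?_, ?_⟩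
  · exact fun p hp hne => H₁ _ (by simp) p hp ((hfix p hp).not.1 hne)
  · exact fun p hp hne => H₂ _ (by simp) p hp ((hfix p hp).not.1 hne)

/-! ### The non-corner case: petals and quantitative estimates -/

/-- The coordinate `-a M x^M`, whose inverse is translated by almost `1` under
`x ↦ x + a x^(M+1) + ⋯`. -/
def petalCoord (a : ℂ) (M : ℕ) (x : ℂ) : ℂ := -(a * M * x ^ M)

/-- The union of the `M` attracting petals of `x ↦ x + a x^(M+1) + ⋯`. -/
def petal (a : ℂ) (M : ℕ) (k ρ : ℝ) : Set ℂ := {x | petalCoord a M x ∈ sector k ∧ ‖x‖ < ρ}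

theorem continuous_petalCoord (a : ℂ) (M : ℕ) : Continuous (petalCoord a M) := by
  unfold petalCoord
  fun_prop

theorem isOpen_petal (a : ℂ) (M : ℕ) (k ρ : ℝ) : IsOpen (petal a M k ρ) :=
  ((isOpen_sector k).preimage (continuous_petalCoord a M)).inter
    (isOpen_lt continuous_norm continuous_const)

theorem petal_mono {a : ℂ} {M : ℕ} {k k' ρ ρ' : ℝ} (hk : 0 < k) (hkk : k ≤ k') (hρ : ρ ≤ ρ') :
    petal a M k ρ ⊆ petal a M k' ρ' :=
  fun _ hx => ⟨sector_mono hk hkk hx.1, hx.2.trans_le hρ⟩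

theorem petalCoord_mul (a : ℂ) (M : ℕ) (x w : ℂ) :
    petalCoord a M (x * w) = petalCoord a M x * w ^ M := by
  simp only [petalCoord]; ring

/-- Quantitative control, on the polydisc of radius `r`, of a map of the form
`(x + x^(M+1) (a + A), y + x^M (c x + b y + B))` with `Re (b/a) < 0`. -/
structure SaddleEstimates (F : ℂ × ℂ → ℂ × ℂ) (M : ℕ) (a b c : ℂ) (A B : ℂ × ℂ → ℂ)
    (k κ C ε r : ℝ) : Prop where
  hM : M ≠ 0
  ha : a ≠ 0
  k_pos : 0 < k
  k_le : k ≤ 1 / 4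
  l_pos : 0 < (-(b / (a * M))).re
  l_im : k * |(-(b / (a * M))).im| ≤ (-(b / (a * M))).re / 2
  κ_pos : 0 < κ
  κ_le : κ ≤ 1 / 4
  κ_pow : ∀ w : ℂ, ‖w‖ < 2 * κ → ‖(1 + w) ^ M - 1‖ ≤ k / 8
  C_nonneg : 0 ≤ C
  ε_pos : 0 < ε
  ε_le : ε * (1 + 8 * (‖c‖ + 1) / ‖a‖) ≤ 1
  ε_le' : ε ≤ (-(b / (a * M))).re * (‖a‖ * M) / 16
  r_pos : 0 < r
  form : ∀ p ∈ Metric.ball (0 : ℂ × ℂ) r, F p =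
      (p.1 + p.1 ^ (M + 1) * (a + A p), p.2 + p.1 ^ M * (c * p.1 + b * p.2 + B p))
  diff_A : DifferentiableOn ℂ A (Metric.ball 0 r)
  diff_B : DifferentiableOn ℂ B (Metric.ball 0 r)
  A_le : ∀ p ∈ Metric.ball (0 : ℂ × ℂ) r, ‖A p‖ ≤ ‖a‖ / 4
  A_lip : ∀ p ∈ Metric.ball (0 : ℂ × ℂ) r, ∀ q ∈ Metric.ball (0 : ℂ × ℂ) r,
    ‖A p - A q‖ ≤ C * ‖p - q‖
  B_lip : ∀ p ∈ Metric.ball (0 : ℂ × ℂ) r, ∀ q ∈ Metric.ball (0 : ℂ × ℂ) r,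
    ‖B p - B q‖ ≤ ε * ‖p - q‖
  B_zero : B 0 = 0
  drift : ∀ p ∈ Metric.ball (0 : ℂ × ℂ) r, 1 + p.1 ^ M * (a + A p) ≠ 0 ∧
    (p.1 ≠ 0 → ‖(petalCoord a M (F p).1)⁻¹ - (petalCoord a M p.1)⁻¹ - 1‖ ≤ k / 8)
  w_lt : ∀ p ∈ Metric.ball (0 : ℂ × ℂ) r, ‖p.1 ^ M * (a + A p)‖ < κ
  v_le : ∀ p ∈ Metric.ball (0 : ℂ × ℂ) r, ‖petalCoord a M p.1‖ ≤ 1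

theorem IsNonCornerForm.exists_saddleEstimates {F : ℂ × ℂ → ℂ × ℂ} {M : ℕ} {a b c : ℂ}
    (h : IsNonCornerForm F M a b c) (hre : (b / a).re < 0) {η : ℝ} (hη : 0 < η) :
    ∃ (A B : ℂ × ℂ → ℂ) (k κ C ε r : ℝ), κ ≤ η ∧ SaddleEstimates F M a b c A B k κ C ε r := by
  obtain ⟨hM, hab, A, B, hA, hB, hform⟩ := h
  have hB0 := hB.map_zero one_le_two
  rw [ordAtLeast_one_iff] at hA
  have hM0 : M ≠ 0 := by omega
  have hMpos : (0 : ℝ) < M := by exact_mod_cast hM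
  have ha : a ≠ 0 := left_ne_zero_of_mul hab
  have hapos : 0 < ‖a‖ := norm_pos_iff.2 ha
  have hl : 0 < (-(b / (a * M))).re := by
    have e : -(b / (a * M)) = ((M : ℝ)⁻¹ : ℝ) * -(b / a) := by
      push_cast
      field_simp
    rw [e, Complex.re_ofReal_mul]
    have : 0 < (-(b / a)).re := by simpa using hre
    positivity
  obtain ⟨k, hk, hk4, hkl⟩ := exists_sector_width _ hl
  obtain ⟨δ, hδ, hδk⟩ : ∃ δ > 0, ∀ w : ℂ, ‖w‖ < δ → ‖(1 + w) ^ M - 1‖ ≤ k / 8 := by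
    have : ContinuousAt (fun w : ℂ => ‖(1 + w) ^ M - 1‖) 0 := by fun_prop
    have := this.eventually_le_const (u := k / 8) (by simpa using hk)
    simpa [Metric.eventually_nhds_iff_ball] using this
  -- `κ` bounds the relative displacement of `x` in one step. The `δ / 2` leaves room for discs of
  -- radius `2κ‖x‖` inside the wider petal; `η` is reserved for the choice of an `M`-th root.
  set κ := min (min (1 / 4) (δ / 2)) η with hκ
  have hκpos : 0 < κ := by positivity
  have hκδ : 2 * κ ≤ δ := by
    have : κ ≤ δ / 2 := (min_le_left _ _).trans (min_le_right _ _)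
    linarith
  -- The first bound gives `‖B‖ ≤ ‖x‖` on the cone containing the graphs; the second gives the
  -- expansion `‖1 + b x^M‖ ≥ 1 + 4ε‖x‖^M`.
  set ε := min (1 + 8 * (‖c‖ + 1) / ‖a‖)⁻¹ ((-(b / (a * M))).re * (‖a‖ * M) / 16) with hε
  have hεpos : 0 < ε := by positivity
  obtain ⟨C, sA, hsA, hlipA⟩ := hA.1.hasStrictFDerivAt.exists_lipschitzOnWith
  -- The translation estimate is reused with `N = 0` and second coefficient 0, so that `m = x^M`.
  have hs : a * M + (0 : ℂ) * ((0 : ℕ) : ℂ) ≠ 0 := by simp [ha, hM0]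
  have hq : Tendsto (fun p : ℂ × ℂ => (p.1 ^ M, a + A p, (0 : ℂ))) (𝓝 0) (𝓝 (0, a, 0)) := by
    have : ContinuousAt (fun p : ℂ × ℂ => (p.1 ^ M, a + A p, (0 : ℂ))) 0 :=
      (by fun_prop : ContinuousAt (fun p : ℂ × ℂ => p.1 ^ M) 0).prodMk
        ((continuousAt_const.add hA.1.continuousAt).prodMk continuousAt_const)
    simpa [ContinuousAt, hA.2, hM0] using this
  have eA : ∀ᶠ p in 𝓝 (0 : ℂ × ℂ), ‖A p‖ ≤ ‖a‖ / 4 :=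
    hA.1.continuousAt.norm.eventually_le_const (by simpa [hA.2] using ha)
  have ew : ∀ᶠ p in 𝓝 (0 : ℂ × ℂ), ‖p.1 ^ M * (a + A p)‖ < κ := by
    have : ContinuousAt (fun p : ℂ × ℂ => p.1 ^ M * (a + A p)) 0 :=
      (by fun_prop : ContinuousAt (fun p : ℂ × ℂ => p.1 ^ M) 0).mul
        (continuousAt_const.add hA.1.continuousAt)
    exact this.norm.eventually_lt_const (by simpa [hM0] using hκpos)
  have ev : ∀ᶠ p in 𝓝 (0 : ℂ × ℂ), ‖petalCoord a M p.1‖ ≤ 1 := by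
    have : ContinuousAt (fun p : ℂ × ℂ => petalCoord a M p.1) 0 :=
      ((continuous_petalCoord a M).comp continuous_fst).continuousAt
    exact this.norm.eventually_le_const (by simp [petalCoord, hM0])
  have eB := hB.hasStrictFDerivAt.isLittleO.def hεpos
  rw [nhds_prod_eq, Metric.nhds_basis_ball.prod_self.eventually_iff] at eB
  obtain ⟨rB, hrB, hlipB⟩ := eB
  obtain ⟨r₁, hr₁, H⟩ := Metric.eventually_nhds_iff_ball.1
    (hform.and (hA.1.eventually_analyticAt.and (hB.1.eventually_analyticAt.and (eA.and
      ((eventually_mem_set.2 hsA).and (ew.and (ev.and (hq.eventually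
        (eventually_drift M 0 a 0 hs (show 0 < k / 8 by positivity))))))))))
  have h1 : Metric.ball (0 : ℂ × ℂ) (min r₁ rB) ⊆ Metric.ball 0 r₁ :=
    Metric.ball_subset_ball (min_le_left _ _)
  have h2 : Metric.ball (0 : ℂ × ℂ) (min r₁ rB) ⊆ Metric.ball 0 rB :=
    Metric.ball_subset_ball (min_le_right _ _)
  refine ⟨A, B, k, κ, C, ε, min r₁ rB, min_le_right _ _, ?_⟩
  exact
    { hM := hM0
      ha := ha
      k_pos := hk
      k_le := hk4
      l_pos := hl
      l_im := hkl
      κ_pos := hκpos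
      κ_le := (min_le_left _ _).trans (min_le_left _ _)
      κ_pow := fun w hw => hδk w (hw.trans_le hκδ)
      C_nonneg := C.2
      ε_pos := hεpos
      ε_le := by
        have h0 : 0 < 1 + 8 * (‖c‖ + 1) / ‖a‖ := by positivity
        calc ε * (1 + 8 * (‖c‖ + 1) / ‖a‖)
            ≤ (1 + 8 * (‖c‖ + 1) / ‖a‖)⁻¹ * (1 + 8 * (‖c‖ + 1) / ‖a‖) := by
              gcongr
              exact min_le_left _ _
          _ = 1 := inv_mul_cancel₀ h0.ne'
      ε_le' := min_le_right _ _
      r_pos := by positivity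
      form := fun p hp => (H p (h1 hp)).1
      diff_A := fun p hp => (H p (h1 hp)).2.1.differentiableAt.differentiableWithinAt
      diff_B := fun p hp => (H p (h1 hp)).2.2.1.differentiableAt.differentiableWithinAt
      A_le := fun p hp => (H p (h1 hp)).2.2.2.1
      A_lip := fun p hp q hq => by
        simpa [dist_eq_norm] using
          hlipA.dist_le_mul p (H p (h1 hp)).2.2.2.2.1 q (H q (h1 hq)).2.2.2.2.1
      B_lip := fun p hp q hq => by
        simpa using hlipB (show (p, q) ∈ _ from ⟨h2 hp, h2 hq⟩)
      B_zero := hB0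
      drift := fun p hp => by
        obtain ⟨f, -, -, -, -, -, -, d1, -, d2⟩ := H p (h1 hp)
        refine ⟨d1, fun hx => ?_⟩
        convert d2 (pow_ne_zero _ hx) using 3
        congr 1
        · have e : p.1 + p.1 ^ (M + 1) * (a + A p) = p.1 * (1 + p.1 ^ M * (a + A p)) := by ring
          rw [f, petalCoord, ← inv_neg, e, mul_pow]
          congr 2
          simp only [Nat.cast_zero, mul_zero, add_zero, pow_zero, mul_one]
        · rw [petalCoord, ← inv_neg]
          simp
      w_lt := fun p hp => (H p (h1 hp)).2.2.2.2.2.1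
      v_le := fun p hp => (H p (h1 hp)).2.2.2.2.2.2.1 }

namespace SaddleEstimates

variable {F : ℂ × ℂ → ℂ × ℂ} {M : ℕ} {a b c : ℂ} {A B : ℂ × ℂ → ℂ} {k κ C ε r : ℝ}

theorem norm_a_pos (h : SaddleEstimates F M a b c A B k κ C ε r) : 0 < ‖a‖ := norm_pos_iff.2 h.ha

theorem M_pos (h : SaddleEstimates F M a b c A B k κ C ε r) : (0 : ℝ) < M := by
  exact_mod_cast Nat.pos_of_ne_zero h.hM

theorem norm_petalCoord (a : ℂ) (M : ℕ) (x : ℂ) : ‖petalCoord a M x‖ = ‖a‖ * M * ‖x‖ ^ M := by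
  simp [petalCoord]

theorem fst_eq (h : SaddleEstimates F M a b c A B k κ C ε r) {p : ℂ × ℂ}
    (hp : p ∈ Metric.ball (0 : ℂ × ℂ) r) : (F p).1 = p.1 * (1 + p.1 ^ M * (a + A p)) := by
  rw [h.form p hp]; ring

theorem snd_eq (h : SaddleEstimates F M a b c A B k κ C ε r) {p : ℂ × ℂ}
    (hp : p ∈ Metric.ball (0 : ℂ × ℂ) r) :
    (F p).2 = (1 + b * p.1 ^ M) * p.2 + p.1 ^ M * (c * p.1 + B p) := by
  rw [h.form p hp]; ring

theorem fst_ne_zero (h : SaddleEstimates F M a b c A B k κ C ε r) {p : ℂ × ℂ}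
    (hp : p ∈ Metric.ball (0 : ℂ × ℂ) r) (hx : p.1 ≠ 0) : (F p).1 ≠ 0 := by
  rw [h.fst_eq hp]
  exact mul_ne_zero hx (h.drift p hp).1

theorem ne_zero_of_mem_petal (h : SaddleEstimates F M a b c A B k κ C ε r) {l ρ : ℝ} {x : ℂ}
    (hx : x ∈ petal a M l ρ) : x ≠ 0 := by
  rintro rfl
  exact ne_zero_of_mem_sector hx.1 (by simp [petalCoord, h.hM])

/-- With `v` the petal coordinate, the multiplier of `x` is `1 - v / M + x^M A`. In the sector `Re
v` dominates both `|Im v|` and the error term, which leaves a contraction. -/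
theorem norm_fst_le (h : SaddleEstimates F M a b c A B k κ C ε r) {p : ℂ × ℂ}
    (hp : p ∈ Metric.ball (0 : ℂ × ℂ) r) (hx : petalCoord a M p.1 ∈ sector k) :
    ‖(F p).1‖ ≤ ‖p.1‖ * (1 - ‖petalCoord a M p.1‖ / (4 * M)) := by
  have hM := h.M_pos
  have hM1 : (1 : ℝ) ≤ M := by exact_mod_cast Nat.one_le_iff_ne_zero.2 h.hM
  have ha := h.norm_a_pos
  have hre := re_pos_of_mem_sector h.k_pos hx
  have hn := norm_le_of_mem_sector hx hre
  have hi : |(petalCoord a M p.1).im| < k * (petalCoord a M p.1).re := hx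
  have hA := h.A_le p hp
  have hv1 := h.v_le p hp
  have hnv := norm_petalCoord a M p.1
  have e : 1 + p.1 ^ M * (a + A p) = (1 - petalCoord a M p.1 / M) + p.1 ^ M * A p := by
    have : (M : ℂ) ≠ 0 := by exact_mod_cast h.hM
    simp only [petalCoord]
    field_simp
    ring
  rw [h.fst_eq hp, norm_mul, e]
  refine mul_le_mul_of_nonneg_left ?_ (norm_nonneg _)
  have h1 : ‖p.1 ^ M * A p‖ ≤ ‖petalCoord a M p.1‖ / (4 * M) := by
    rw [norm_mul, norm_pow, hnv]
    calc ‖p.1‖ ^ M * ‖A p‖ ≤ ‖p.1‖ ^ M * (‖a‖ / 4) := by gcongr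
      _ = _ := by field_simp
  set v := petalCoord a M p.1 with hvdef
  have hre1 : v.re / M ≤ 1 := by
    rw [div_le_one hM]
    exact (Complex.re_le_norm v).trans (hv1.trans hM1)
  have h2 : ‖1 - v / M‖ ≤ 1 - v.re / M + |v.im| / M := by
    refine (Complex.norm_le_abs_re_add_abs_im _).trans (le_of_eq ?_)
    have e1 : (1 - v / M).re = 1 - v.re / M := by
      simp [← Complex.ofReal_natCast, Complex.div_ofReal_re]
    have e2 : (1 - v / M).im = -(v.im / M) := by
      simp [← Complex.ofReal_natCast, Complex.div_ofReal_im]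
    rw [e1, e2, abs_neg, abs_div, abs_of_pos hM, abs_of_nonneg (by linarith)]
  have hk := h.k_le
  have h3 : ‖v‖ / M ≤ (5 / 4) * (v.re / M) := by
    rw [mul_div_assoc']
    gcongr
    nlinarith
  have h4 : |v.im| / M ≤ (1 / 4) * (v.re / M) := by
    rw [mul_div_assoc']
    gcongr
    nlinarith
  have h5 : ‖v‖ / (4 * M) = (‖v‖ / M) / 4 := by field_simp
  have := norm_add_le (1 - v / M) (p.1 ^ M * A p)
  have h6 : 0 ≤ ‖v‖ / M := by positivity
  linarith

theorem norm_fst_le_norm (h : SaddleEstimates F M a b c A B k κ C ε r) {p : ℂ × ℂ}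
    (hp : p ∈ Metric.ball (0 : ℂ × ℂ) r) (hx : petalCoord a M p.1 ∈ sector k) :
    ‖(F p).1‖ ≤ ‖p.1‖ := by
  refine (h.norm_fst_le hp hx).trans (mul_le_of_le_one_right (norm_nonneg _) ?_)
  have := h.M_pos
  have : 0 ≤ ‖petalCoord a M p.1‖ / (4 * M) := by positivity
  linarith

theorem fst_mem_petal (h : SaddleEstimates F M a b c A B k κ C ε r) {p : ℂ × ℂ}
    (hp : p ∈ Metric.ball (0 : ℂ × ℂ) r) {l ρ : ℝ} (hl : k / 2 ≤ l) (hlk : l ≤ k)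
    (hx : p.1 ∈ petal a M l ρ) : (F p).1 ∈ petal a M l ρ := by
  have hk := h.k_pos
  have hk4 := h.k_le
  refine ⟨?_, (h.norm_fst_le_norm hp (sector_mono (by linarith) hlk hx.1)).trans_lt hx.2⟩
  have := mem_sector_of_drift (by nlinarith) (by linarith)
    ((h.drift p hp).2 (h.ne_zero_of_mem_petal hx)) (inv_mem_sector hx.1)
  simpa using inv_mem_sector this

/-- Take the `M`-th power of the contraction and use `(1 - t)⁻¹ ≥ 1 + t` with `t = ‖a‖‖x‖^M / 4`.
Iterated, this gives the decay of order `n^(-1/M)` along petals. -/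
theorem inv_pow_add_le (h : SaddleEstimates F M a b c A B k κ C ε r) {p : ℂ × ℂ}
    (hp : p ∈ Metric.ball (0 : ℂ × ℂ) r) (hx : petalCoord a M p.1 ∈ sector k) :
    (‖p.1‖ ^ M)⁻¹ + ‖a‖ / 4 ≤ (‖(F p).1‖ ^ M)⁻¹ := by
  have hM := h.M_pos
  have ha := h.norm_a_pos
  have hx0 : p.1 ≠ 0 := h.ne_zero_of_mem_petal (ρ := ‖p.1‖ + 1) ⟨hx, by linarith⟩
  have h0 : 0 < ‖p.1‖ := norm_pos_iff.2 hx0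
  have h1 : 0 < ‖(F p).1‖ := norm_pos_iff.2 (h.fst_ne_zero hp hx0)
  have hle := h.norm_fst_le hp hx
  set t := ‖petalCoord a M p.1‖ / (4 * M) with ht
  have ht0 : 0 ≤ t := by positivity
  have htq : t * (‖p.1‖ ^ M)⁻¹ = ‖a‖ / 4 := by
    rw [ht, norm_petalCoord]
    field_simp
  have ht1 : 0 ≤ 1 - t := by
    by_contra hneg
    nlinarith
  have ht1' : (1 - t) ^ M ≤ 1 - t :=
    pow_le_of_le_one ht1 (by linarith) h.hM
  have h2 : ‖(F p).1‖ ^ M ≤ ‖p.1‖ ^ M * (1 - t) :=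
    calc ‖(F p).1‖ ^ M ≤ (‖p.1‖ * (1 - t)) ^ M := by gcongr
      _ = ‖p.1‖ ^ M * (1 - t) ^ M := mul_pow _ _ _
      _ ≤ _ := by gcongr
  have h3 : 0 < ‖(F p).1‖ ^ M := by positivity
  have h4 : 0 < ‖p.1‖ ^ M := by positivity
  rw [← htq, le_inv_comm₀ (by positivity) h3]
  refine h2.trans ?_
  rw [show (‖p.1‖ ^ M)⁻¹ + t * (‖p.1‖ ^ M)⁻¹ = (‖p.1‖ ^ M)⁻¹ * (1 + t) by ring, mul_inv, inv_inv]
  gcongr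
  rw [← one_div, le_div_iff₀ (by linarith)]
  nlinarith

/-- `b x^M` is the petal coordinate times `-(b / (a M))`, whose real part is positive. The surplus
`4ε‖x‖^M` pays for all the error terms in the fibre direction. -/
theorem one_add_le_norm (h : SaddleEstimates F M a b c A B k κ C ε r) {x : ℂ}
    (hx : petalCoord a M x ∈ sector k) :
    1 + 4 * ε * ‖x‖ ^ M ≤ ‖1 + b * x ^ M‖ := by
  have hM := h.M_pos
  have hM0 : (M : ℂ) ≠ 0 := by exact_mod_cast h.hM
  have ha := h.norm_a_pos
  have h1 := re_mul_ge_of_mem_sector h.k_pos (h.k_le.trans (by norm_num)) h.l_pos h.l_im hx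
  have e : -(b / (a * M)) * petalCoord a M x = b * x ^ M := by
    have := h.ha
    simp only [petalCoord]
    field_simp
  rw [e, norm_petalCoord] at h1
  have h2 := h.ε_le'
  refine le_trans ?_ (Complex.re_le_norm _)
  rw [Complex.add_re, Complex.one_re]
  have h3 := mul_le_mul_of_nonneg_right h2 (by positivity : 0 ≤ ‖x‖ ^ M)
  linarith

theorem one_add_ne_zero (h : SaddleEstimates F M a b c A B k κ C ε r) {x : ℂ}
    (hx : petalCoord a M x ∈ sector k) : 1 + b * x ^ M ≠ 0 := by
  have h1 := h.one_add_le_norm hx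
  have h2 := h.ε_pos
  have : 0 < ‖1 + b * x ^ M‖ := lt_of_lt_of_le (by positivity) h1
  exact norm_pos_iff.1 this

/-- Halving the width and radius of a petal leaves a margin proportional to `‖x‖`, as needed for
Cauchy estimates on discs centred at `x`. -/
theorem mem_petal_of_near (h : SaddleEstimates F M a b c A B k κ C ε r) {x z : ℂ} {ρ : ℝ}
    (hx : x ∈ petal a M (k / 2) (ρ / 2)) (hz : ‖z - x‖ < 2 * κ * ‖x‖) : z ∈ petal a M k ρ := by
  have hx0 := h.ne_zero_of_mem_petal hx
  have h0 : 0 < ‖x‖ := norm_pos_iff.2 hx0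
  have hk := h.k_pos
  have hk4 := h.k_le
  have hκ := h.κ_le
  constructor
  · have e : z = x * (1 + (z - x) / x) := by field_simp; ring
    rw [e, petalCoord_mul]
    have hw : ‖(z - x) / x‖ < 2 * κ := by rwa [norm_div, div_lt_iff₀ h0]
    have h4 : (1 + k / 2) * (1 + 2 * (k / 2)) ≤ 4 := by nlinarith
    have := mul_mem_sector (k := k / 2) (by linarith) hx.1 (h.κ_pow _ hw) (by nlinarith)
    rwa [add_sub_cancel, mul_div_cancel₀ _ two_ne_zero] at this
  · have h1 := norm_le_norm_add_norm_sub' z x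
    have h2 : ‖x‖ < ρ / 2 := hx.2
    have h3 := norm_sub_norm_le z x
    nlinarith

end SaddleEstimates

/-! ### Graph transform and the invariant graph -/

/-- The slope bound for the invariant graphs over the petals. -/
noncomputable def graphSlope (a c : ℂ) : ℝ := 8 * (‖c‖ + 1) / ‖a‖

/-- `ψ` is holomorphic on the petals of size `ρ`, and its graph lies in a cone. -/
def IsConeGraph (a : ℂ) (M : ℕ) (c : ℂ) (k ρ : ℝ) (ψ : ℂ → ℂ) : Prop :=
  DifferentiableOn ℂ ψ (petal a M k ρ) ∧ ∀ x ∈ petal a M k ρ, ‖ψ x‖ ≤ graphSlope a c * ‖x‖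

/-- The operator whose fixed points are the functions with invariant graph. -/
noncomputable def graphTransform (F : ℂ × ℂ → ℂ × ℂ) (M : ℕ) (b c : ℂ) (B : ℂ × ℂ → ℂ)
    (ψ : ℂ → ℂ) (x : ℂ) : ℂ :=
  (ψ (F (x, ψ x)).1 - x ^ M * (c * x + B (x, ψ x))) / (1 + b * x ^ M)

theorem mk_mem_ball {x y : ℂ} {K ρ r : ℝ} (hK : 0 ≤ K) (hρ : ρ * (1 + K) ≤ r) (hx : ‖x‖ < ρ)
    (hy : ‖y‖ ≤ K * ‖x‖) : (x, y) ∈ Metric.ball (0 : ℂ × ℂ) r := by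
  have h0 := norm_nonneg x
  rw [mem_ball_zero_iff, Prod.norm_def, max_lt_iff]
  constructor <;> simp only <;> nlinarith

namespace SaddleEstimates

variable {F : ℂ × ℂ → ℂ × ℂ} {M : ℕ} {a b c : ℂ} {A B : ℂ × ℂ → ℂ} {k κ C ε r ρ : ℝ}

theorem graphSlope_pos (h : SaddleEstimates F M a b c A B k κ C ε r) : 0 < graphSlope a c := by
  have := h.norm_a_pos
  unfold graphSlope
  positivity

theorem norm_B_le (h : SaddleEstimates F M a b c A B k κ C ε r) {x y : ℂ}
    (hp : (x, y) ∈ Metric.ball (0 : ℂ × ℂ) r) (hy : ‖y‖ ≤ graphSlope a c * ‖x‖) :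
    ‖B (x, y)‖ ≤ ‖x‖ := by
  have h1 := h.B_lip _ hp 0 (Metric.mem_ball_self h.r_pos)
  rw [h.B_zero, sub_zero, sub_zero] at h1
  have hK := h.graphSlope_pos
  have h2 : ‖(x, y)‖ ≤ (1 + graphSlope a c) * ‖x‖ := by
    rw [Prod.norm_def, max_le_iff]
    have := norm_nonneg x
    constructor <;> simp only <;> nlinarith
  have h3 : ε * (1 + graphSlope a c) ≤ 1 := h.ε_le
  have h4 := h.ε_pos
  calc _ ≤ ε * ((1 + graphSlope a c) * ‖x‖) := h1.trans (by gcongr)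
    _ = (ε * (1 + graphSlope a c)) * ‖x‖ := by ring
    _ ≤ 1 * ‖x‖ := by gcongr
    _ = ‖x‖ := one_mul _

/-- The contraction of `x` lowers the cone bound by `graphSlope * ‖a‖ * ‖x‖^(M+1) / 4 = 2 (‖c‖ + 1)
‖x‖^(M+1)`, twice the size of the forcing term; this dictates the 8 in `graphSlope`. Dividing by `1
+ b x^M` only helps. -/
theorem isConeGraph_graphTransform (h : SaddleEstimates F M a b c A B k κ C ε r)
    (hρ : ρ * (1 + graphSlope a c) ≤ r) {ψ : ℂ → ℂ} (hψ : IsConeGraph a M c k ρ ψ) :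
    IsConeGraph a M c k ρ (graphTransform F M b c B ψ) := by
  have hK := h.graphSlope_pos
  have hball : ∀ x ∈ petal a M k ρ, (x, ψ x) ∈ Metric.ball (0 : ℂ × ℂ) r :=
    fun x hx => mk_mem_ball hK.le hρ hx.2 (hψ.2 x hx)
  have hstep : ∀ x ∈ petal a M k ρ, (F (x, ψ x)).1 ∈ petal a M k ρ := fun x hx =>
    h.fst_mem_petal (hball x hx) (by linarith [h.k_pos]) le_rfl hx
  constructor
  · have hid : DifferentiableOn ℂ (fun x : ℂ => x) (petal a M k ρ) := differentiableOn_id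
    have hpair : DifferentiableOn ℂ (fun x => (x, ψ x)) (petal a M k ρ) :=
      differentiableOn_id.prodMk hψ.1
    have hA : DifferentiableOn ℂ (fun x => A (x, ψ x)) (petal a M k ρ) :=
      h.diff_A.fun_comp hpair hball
    have hB : DifferentiableOn ℂ (fun x => B (x, ψ x)) (petal a M k ρ) :=
      h.diff_B.fun_comp hpair hball
    have hX : DifferentiableOn ℂ (fun x => (F (x, ψ x)).1) (petal a M k ρ) := by
      have : DifferentiableOn ℂ (fun x => x * (1 + x ^ M * (a + A (x, ψ x)))) (petal a M k ρ) :=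
        hid.mul ((differentiableOn_const 1).add
          ((hid.pow M).mul ((differentiableOn_const a).add hA)))
      exact this.congr fun x hx => h.fst_eq (hball x hx)
    have hψX : DifferentiableOn ℂ (fun x => ψ (F (x, ψ x)).1) (petal a M k ρ) :=
      hψ.1.fun_comp hX hstep
    unfold graphTransform
    refine DifferentiableOn.fun_div (hψX.sub ((hid.pow M).mul
      (((differentiableOn_const c).mul hid).add hB))) (by fun_prop)
        fun x hx => h.one_add_ne_zero hx.1
  · intro x hx
    have h1 := h.one_add_le_norm hx.1
    have hB := h.norm_B_le (hball x hx) (hψ.2 x hx)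
    have hX := h.norm_fst_le (hball x hx) hx.1
    have hψX := hψ.2 _ (hstep x hx)
    have hx0 := norm_nonneg x
    have hε := h.ε_pos
    have ha := h.norm_a_pos
    have hM := h.M_pos
    have hpos : 0 ≤ 4 * ε * ‖x‖ ^ M := by positivity
    rw [graphTransform, norm_div, div_le_iff₀ (by linarith)]
    have h2 : ‖x ^ M * (c * x + B (x, ψ x))‖ ≤ ‖x‖ ^ M * ((‖c‖ + 1) * ‖x‖) := by
      rw [norm_mul, norm_pow]
      gcongr
      refine (norm_add_le _ _).trans ?_
      rw [norm_mul]
      linarith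
    have h3 : graphSlope a c * ‖(F (x, ψ x)).1‖ ≤
        graphSlope a c * ‖x‖ - 2 * (‖x‖ ^ M * ((‖c‖ + 1) * ‖x‖)) := by
      refine (mul_le_mul_of_nonneg_left hX hK.le).trans (le_of_eq ?_)
      simp only [norm_petalCoord, graphSlope]
      field_simp
      ring
    have h4 := norm_sub_le (ψ (F (x, ψ x)).1) (x ^ M * (c * x + B (x, ψ x)))
    have h5 : 0 ≤ ‖x‖ ^ M * ((‖c‖ + 1) * ‖x‖) := by positivity
    have h6 : graphSlope a c * ‖x‖ * 1 ≤ graphSlope a c * ‖x‖ * ‖1 + b * x ^ M‖ := by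
      gcongr
      linarith
    linarith

/-- Cauchy's estimate on discs of radius `κ‖x‖`, where the cone condition gives `‖ψ‖ ≤ 2 *
graphSlope * ‖x‖`. The factor `‖x‖` cancels, so the constant is uniform up to the vertex of the
petal. -/
theorem lipschitz_near (h : SaddleEstimates F M a b c A B k κ C ε r) {ψ : ℂ → ℂ}
    (hψ : IsConeGraph a M c k ρ ψ) {x : ℂ} (hx : x ∈ petal a M (k / 2) (ρ / 2)) {z z' : ℂ}
    (hz : ‖z - x‖ < κ * ‖x‖) (hz' : ‖z' - x‖ < κ * ‖x‖) :
    ‖ψ z - ψ z'‖ ≤ 2 * graphSlope a c / κ * ‖z - z'‖ := by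
  have hx0 : 0 < ‖x‖ := norm_pos_iff.2 (h.ne_zero_of_mem_petal hx)
  have hκ := h.κ_pos
  have hK := h.graphSlope_pos
  have hsub : Metric.ball x (2 * κ * ‖x‖) ⊆ petal a M k ρ := fun w hw =>
    h.mem_petal_of_near hx (by rwa [← dist_eq_norm])
  have hdiff : DifferentiableOn ℂ ψ (Metric.ball x (2 * κ * ‖x‖)) := hψ.1.mono hsub
  have hbound : ∀ w ∈ Metric.ball x (2 * κ * ‖x‖), ‖ψ w‖ ≤ 2 * graphSlope a c * ‖x‖ := by
    intro w hw
    have h1 := hψ.2 w (hsub hw)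
    have h2 := norm_sub_norm_le w x
    rw [mem_ball_iff_norm] at hw
    have hκ4 := h.κ_le
    have : ‖w‖ ≤ 2 * ‖x‖ := by nlinarith
    nlinarith
  refine Convex.norm_image_sub_le_of_norm_deriv_le (s := Metric.ball x (κ * ‖x‖))
    (fun w hw => ?_) (fun w hw => ?_) (convex_ball _ _) (mem_ball_iff_norm.2 hz')
    (mem_ball_iff_norm.2 hz)
  · exact hdiff.differentiableAt (Metric.isOpen_ball.mem_nhds
      (Metric.ball_subset_ball (by nlinarith) hw))
  · have hcl : Metric.closedBall w (κ * ‖x‖) ⊆ Metric.ball x (2 * κ * ‖x‖) := by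
      refine Metric.closedBall_subset_ball' ?_
      have := Metric.mem_ball.1 hw
      linarith
    have := Complex.norm_deriv_le_of_forall_mem_sphere_norm_le (by positivity : 0 < κ * ‖x‖)
      ((hdiff.mono hcl).diffContOnCl_ball subset_rfl)
      (fun v hv => hbound v (hcl (Metric.sphere_subset_closedBall hv)))
    refine this.trans (le_of_eq ?_)
    field_simp

theorem norm_fst_sub_lt (h : SaddleEstimates F M a b c A B k κ C ε r) {p : ℂ × ℂ}
    (hp : p ∈ Metric.ball (0 : ℂ × ℂ) r) (hx : p.1 ≠ 0) : ‖(F p).1 - p.1‖ < κ * ‖p.1‖ := by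
  have h1 := h.w_lt p hp
  rw [h.fst_eq hp, mul_add, mul_one, add_sub_cancel_left, norm_mul, mul_comm]
  gcongr

/-- Moving the base point along the fibre changes `ψ ∘ (F ·).1` by little. -/
theorem norm_comp_fst_sub_le (h : SaddleEstimates F M a b c A B k κ C ε r)
    (hρC : ρ * (2 * graphSlope a c / κ * C) ≤ ε) {ψ : ℂ → ℂ} (hψ : IsConeGraph a M c k ρ ψ)
    {x y y' : ℂ} (hx : x ∈ petal a M (k / 2) (ρ / 2)) (hy : (x, y) ∈ Metric.ball (0 : ℂ × ℂ) r)
    (hy' : (x, y') ∈ Metric.ball (0 : ℂ × ℂ) r) :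
    ‖ψ (F (x, y)).1 - ψ (F (x, y')).1‖ ≤ ε * ‖x‖ ^ M * ‖y - y'‖ := by
  have hx0 := h.ne_zero_of_mem_petal hx
  have h1 := h.lipschitz_near hψ hx (h.norm_fst_sub_lt hy hx0) (h.norm_fst_sub_lt hy' hx0)
  refine h1.trans ?_
  have h2 : ‖(F (x, y)).1 - (F (x, y')).1‖ ≤ ‖x‖ ^ (M + 1) * (C * ‖y - y'‖) := by
    have e : (F (x, y)).1 - (F (x, y')).1 = x ^ (M + 1) * (A (x, y) - A (x, y')) := by
      rw [h.form _ hy, h.form _ hy']; ring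
    rw [e, norm_mul, norm_pow]
    gcongr
    refine (h.A_lip _ hy _ hy').trans (le_of_eq ?_)
    simp [Prod.norm_def]
  have hκ := h.κ_pos
  have hK := h.graphSlope_pos
  have hC := h.C_nonneg
  have hxρ : ‖x‖ ≤ ρ := by
    have h3 : ‖x‖ < ρ / 2 := hx.2
    have := norm_nonneg x
    linarith
  calc _ ≤ 2 * graphSlope a c / κ * (‖x‖ ^ (M + 1) * (C * ‖y - y'‖)) := by gcongr
    _ = ‖x‖ * (2 * graphSlope a c / κ * C) * (‖x‖ ^ M * ‖y - y'‖) := by ring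
    _ ≤ ρ * (2 * graphSlope a c / κ * C) * (‖x‖ ^ M * ‖y - y'‖) := by gcongr
    _ ≤ ε * (‖x‖ ^ M * ‖y - y'‖) := by gcongr
    _ = _ := by ring

theorem norm_B_sub_le (h : SaddleEstimates F M a b c A B k κ C ε r) {x y y' : ℂ}
    (hy : (x, y) ∈ Metric.ball (0 : ℂ × ℂ) r) (hy' : (x, y') ∈ Metric.ball (0 : ℂ × ℂ) r) :
    ‖B (x, y) - B (x, y')‖ ≤ ε * ‖y - y'‖ := by
  simpa [Prod.norm_def] using h.B_lip _ hy _ hy'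

/-- The numerator is at most `D`, plus `2Dε‖x‖^M` from moving the base point, plus `2Dε‖x‖^M` from
`B`. The sum `D (1 + 4ε‖x‖^M)` is exactly what the denominator absorbs. -/
theorem norm_graphTransform_sub_le (h : SaddleEstimates F M a b c A B k κ C ε r)
    (hρ : ρ * (1 + graphSlope a c) ≤ r) (hρC : ρ * (2 * graphSlope a c / κ * C) ≤ ε)
    {ψ χ : ℂ → ℂ} (hψ : IsConeGraph a M c k ρ ψ) (hχ : IsConeGraph a M c k ρ χ)
    {x : ℂ} (hx : x ∈ petal a M (k / 2) (ρ / 2)) {D : ℝ} (hD : ‖ψ x - χ x‖ ≤ 2 * D)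
    (hD' : ‖ψ (F (x, ψ x)).1 - χ (F (x, ψ x)).1‖ ≤ D) :
    ‖graphTransform F M b c B ψ x - graphTransform F M b c B χ x‖ ≤ D := by
  have hK := h.graphSlope_pos
  have hk := h.k_pos
  have hε := h.ε_pos
  have hxρ : x ∈ petal a M k ρ := petal_mono (by linarith) (by linarith)
    (by linarith [(norm_nonneg x).trans_lt hx.2]) hx
  have b1 : (x, ψ x) ∈ Metric.ball (0 : ℂ × ℂ) r := mk_mem_ball hK.le hρ hxρ.2 (hψ.2 x hxρ)
  have b2 : (x, χ x) ∈ Metric.ball (0 : ℂ × ℂ) r := mk_mem_ball hK.le hρ hxρ.2 (hχ.2 x hxρ)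
  have h1 := h.one_add_le_norm hxρ.1
  have h2 := h.norm_comp_fst_sub_le hρC hχ hx b1 b2
  have h3 := h.norm_B_sub_le b1 b2
  have h4 : ‖x ^ M * (B (x, ψ x) - B (x, χ x))‖ ≤ ε * ‖x‖ ^ M * ‖ψ x - χ x‖ := by
    rw [norm_mul, norm_pow]
    calc _ ≤ ‖x‖ ^ M * (ε * ‖ψ x - χ x‖) := by gcongr
      _ = _ := by ring
  have e : graphTransform F M b c B ψ x - graphTransform F M b c B χ x =
      ((ψ (F (x, ψ x)).1 - χ (F (x, ψ x)).1) + (χ (F (x, ψ x)).1 - χ (F (x, χ x)).1)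
        - x ^ M * (B (x, ψ x) - B (x, χ x))) / (1 + b * x ^ M) := by
    simp only [graphTransform]
    rw [← sub_div]
    ring
  have hpos : 0 ≤ ε * ‖x‖ ^ M := by positivity
  rw [e, norm_div, div_le_iff₀ (by linarith)]
  have h5 := norm_sub_le ((ψ (F (x, ψ x)).1 - χ (F (x, ψ x)).1) +
    (χ (F (x, ψ x)).1 - χ (F (x, χ x)).1)) (x ^ M * (B (x, ψ x) - B (x, χ x)))
  have h6 := norm_add_le (ψ (F (x, ψ x)).1 - χ (F (x, ψ x)).1)
    (χ (F (x, ψ x)).1 - χ (F (x, χ x)).1)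
  have h7 : ε * ‖x‖ ^ M * ‖ψ x - χ x‖ ≤ ε * ‖x‖ ^ M * (2 * D) := by gcongr
  have hD0 : 0 ≤ D := (norm_nonneg _).trans hD'
  have h8 : D * (1 + 4 * ε * ‖x‖ ^ M) ≤ D * ‖1 + b * x ^ M‖ := by gcongr
  linarith

end SaddleEstimates

namespace SaddleEstimates

variable {F : ℂ × ℂ → ℂ × ℂ} {M : ℕ} {a b c : ℂ} {A B : ℂ × ℂ → ℂ} {k κ C ε r ρ : ℝ}

theorem le_inv_pow (h : SaddleEstimates F M a b c A B k κ C ε r) {x : ℂ}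
    (hx : (x, 0) ∈ Metric.ball (0 : ℂ × ℂ) r) (hx0 : x ≠ 0) : ‖a‖ / 4 ≤ (‖x‖ ^ M)⁻¹ := by
  have h1 := h.v_le _ hx
  rw [norm_petalCoord] at h1
  have h0 : 0 < ‖x‖ := norm_pos_iff.2 hx0
  have hM1 : (1 : ℝ) ≤ M := by exact_mod_cast Nat.one_le_iff_ne_zero.2 h.hM
  have ha := h.norm_a_pos
  have h2 : 0 < ‖x‖ ^ M := by positivity
  rw [← one_div, le_div_iff₀ h2]
  calc ‖a‖ / 4 * ‖x‖ ^ M ≤ ‖a‖ * M * ‖x‖ ^ M := by gcongr; nlinarith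
    _ ≤ 1 := h1

theorem isConeGraph_iterate (h : SaddleEstimates F M a b c A B k κ C ε r)
    (hρ : ρ * (1 + graphSlope a c) ≤ r) (n : ℕ) :
    IsConeGraph a M c k ρ ((graphTransform F M b c B)^[n] 0) := by
  induction n with
  | zero =>
    have := h.graphSlope_pos
    refine ⟨differentiableOn_const 0, fun x _ => ?_⟩
    simp only [Function.iterate_zero, id_eq, Pi.zero_apply, norm_zero]
    positivity
  | succ n ih =>
    rw [Function.iterate_succ_apply']
    exact h.isConeGraph_graphTransform hρ ih

/-- The iterates of the zero graph under the graph transform form a Cauchy sequence. -/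
theorem norm_iterate_graphTransform_sub_le (h : SaddleEstimates F M a b c A B k κ C ε r)
    (hρ : ρ * (1 + graphSlope a c) ≤ r) (hρC : ρ * (2 * graphSlope a c / κ * C) ≤ ε)
    (n i : ℕ) {x : ℂ} (hx : x ∈ petal a M (k / 2) (ρ / 2)) :
    ‖(graphTransform F M b c B)^[n] 0 x - (graphTransform F M b c B)^[n + i] 0 x‖ ≤
      2 * graphSlope a c * ((‖x‖ ^ M)⁻¹ + ‖a‖ / 4 * n) ^ (-(M : ℝ)⁻¹) := by
  have hK := h.graphSlope_pos
  have hk := h.k_pos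
  have ha := h.norm_a_pos
  have hM1 : (1 : ℝ) ≤ M := by exact_mod_cast Nat.one_le_iff_ne_zero.2 h.hM
  have hcone : ∀ n, IsConeGraph a M c k ρ ((graphTransform F M b c B)^[n] 0) := h.isConeGraph_iterate hρ
  have hsub : petal a M (k / 2) (ρ / 2) ⊆ petal a M k ρ := fun x hx =>
    petal_mono (by linarith) (by linarith) (by linarith [(norm_nonneg x).trans_lt hx.2]) hx
  induction n generalizing x with
  | zero =>
    have h0 := norm_nonneg x
    have h1 := (hcone i).2 x (hsub hx)
    have e : ((‖x‖ ^ M)⁻¹ + ‖a‖ / 4 * (0 : ℕ)) ^ (-(M : ℝ)⁻¹) = ‖x‖ := by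
      rw [Nat.cast_zero, mul_zero, add_zero, Real.rpow_neg (by positivity),
        Real.inv_rpow (by positivity), inv_inv, Real.pow_rpow_inv_natCast h0 h.hM]
    rw [e, zero_add, Function.iterate_zero, id_eq, Pi.zero_apply, zero_sub, norm_neg]
    nlinarith
  | succ n ih =>
    have hx0 := h.ne_zero_of_mem_petal hx
    have hxn : 0 < ‖x‖ := norm_pos_iff.2 hx0
    have hball : (x, (graphTransform F M b c B)^[n] 0 x) ∈ Metric.ball (0 : ℂ × ℂ) r :=
      mk_mem_ball hK.le hρ (hsub hx).2 ((hcone n).2 x (hsub hx))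
    have hball0 : (x, (0 : ℂ)) ∈ Metric.ball (0 : ℂ × ℂ) r :=
      mk_mem_ball hK.le hρ (hsub hx).2 (by rw [norm_zero]; positivity)
    have hq := h.le_inv_pow hball0 hx0
    rw [add_right_comm, Function.iterate_succ_apply', Function.iterate_succ_apply']
    refine h.norm_graphTransform_sub_le hρ hρC (hcone n) (hcone (n + i)) hx ?_ ?_
    · refine (ih hx).trans ?_
      set q := (‖x‖ ^ M)⁻¹ with hqdef
      have hqpos : 0 < q + ‖a‖ / 4 * n := by positivity
      -- Since `q ≥ ‖a‖ / 4`, one more step at most doubles the base, so the weight loses at most a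
      -- factor 2: this is the slack `2 * D` allowed at `x` itself.
      have h2 : (2 * (q + ‖a‖ / 4 * n)) ^ (-(M : ℝ)⁻¹) ≤
          (q + ‖a‖ / 4 * (n + 1 : ℕ)) ^ (-(M : ℝ)⁻¹) := by
        refine Real.rpow_le_rpow_of_nonpos (by positivity) ?_ (by simp)
        push_cast
        have : 0 ≤ ‖a‖ / 4 * n := by positivity
        linarith
      rw [Real.mul_rpow (by norm_num) hqpos.le] at h2
      have h3 : (2 : ℝ)⁻¹ ≤ 2 ^ (-(M : ℝ)⁻¹) := by
        rw [← Real.rpow_neg_one]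
        refine Real.rpow_le_rpow_of_exponent_le (by norm_num) (neg_le_neg ?_)
        exact inv_le_one_of_one_le₀ hM1
      have h4 : 0 ≤ (q + ‖a‖ / 4 * n) ^ (-(M : ℝ)⁻¹) := by positivity
      have h5 := mul_le_mul_of_nonneg_right h3 h4
      have h6 := mul_le_mul_of_nonneg_left (h5.trans h2) hK.le
      linarith
    · refine (ih (h.fst_mem_petal hball le_rfl (by linarith) hx)).trans ?_
      have h2 := h.inv_pow_add_le hball (hsub hx).1
      gcongr 2 * graphSlope a c * ?_
      refine Real.rpow_le_rpow_of_nonpos (by positivity) ?_ (by simp)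
      push_cast
      linarith

/-- Existence of the invariant graph over the attracting petals. -/
theorem exists_invariant_graph (h : SaddleEstimates F M a b c A B k κ C ε r)
    (hρ : ρ * (1 + graphSlope a c) ≤ r) (hρC : ρ * (2 * graphSlope a c / κ * C) ≤ ε) :
    ∃ ψ : ℂ → ℂ, IsConeGraph a M c (k / 2) (ρ / 2) ψ ∧
      (∀ x ∈ petal a M (k / 2) (ρ / 2), (F (x, ψ x)).2 = ψ (F (x, ψ x)).1) ∧
      ∀ x ∈ petal a M (k / 2) (ρ / 2), ∀ y y', (x, y) ∈ Metric.ball (0 : ℂ × ℂ) r →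
        (x, y') ∈ Metric.ball (0 : ℂ × ℂ) r →
        ‖ψ (F (x, y)).1 - ψ (F (x, y')).1‖ ≤ ε * ‖x‖ ^ M * ‖y - y'‖ := by
  have hK := h.graphSlope_pos
  have hk := h.k_pos
  have ha := h.norm_a_pos
  have hε := h.ε_pos
  have hM := h.M_pos
  set T := graphTransform F M b c B with hT
  have hcone : ∀ n, IsConeGraph a M c k ρ (T^[n] 0) := h.isConeGraph_iterate hρ
  have hsub : petal a M (k / 2) (ρ / 2) ⊆ petal a M k ρ := fun x hx =>
    petal_mono (by linarith) (by linarith) (by linarith [(norm_nonneg x).trans_lt hx.2]) hx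
  have hball : ∀ x ∈ petal a M (k / 2) (ρ / 2), ∀ y, ‖y‖ ≤ graphSlope a c * ‖x‖ →
      (x, y) ∈ Metric.ball (0 : ℂ × ℂ) r := fun x hx y hy =>
    mk_mem_ball hK.le hρ (hsub hx).2 hy
  let G : ℕ → ℝ := fun n => 2 * graphSlope a c * (‖a‖ / 4 * (n + 1)) ^ (-(M : ℝ)⁻¹)
  have hG : Tendsto G atTop (𝓝 0) := by
    have h1 : Tendsto (fun n : ℕ => ‖a‖ / 4 * ((n : ℝ) + 1)) atTop atTop :=
      (tendsto_atTop_add_const_right _ _ tendsto_natCast_atTop_atTop).const_mul_atTop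
        (by positivity)
    have h2 := (tendsto_rpow_neg_atTop (inv_pos.2 hM)).comp h1
    simpa [G] using h2.const_mul (2 * graphSlope a c)
  have hdist : ∀ x ∈ petal a M (k / 2) (ρ / 2), ∀ n i, ‖T^[n] 0 x - T^[n + i] 0 x‖ ≤ G n := by
    intro x hx n i
    refine (h.norm_iterate_graphTransform_sub_le hρ hρC n i hx).trans ?_
    have hq := h.le_inv_pow (hball x hx 0 (by rw [norm_zero]; positivity))
      (h.ne_zero_of_mem_petal hx)
    simp only [G]
    gcongr 2 * graphSlope a c * ?_
    refine Real.rpow_le_rpow_of_nonpos (by positivity) ?_ (by simp)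
    linarith
  have hlim : ∀ x, ∃ y, x ∈ petal a M (k / 2) (ρ / 2) →
      Tendsto (fun n => T^[n] 0 x) atTop (𝓝 y) := by
    intro x
    by_cases hx : x ∈ petal a M (k / 2) (ρ / 2)
    · have : CauchySeq (fun n => T^[n] 0 x) := by
        refine cauchySeq_of_le_tendsto_0' G (fun n m hnm => ?_) hG
        obtain ⟨i, rfl⟩ := Nat.exists_eq_add_of_le hnm
        rw [dist_eq_norm]
        exact hdist x hx n i
      obtain ⟨y, hy⟩ := cauchySeq_tendsto_of_complete this
      exact ⟨y, fun _ => hy⟩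
    · exact ⟨0, fun h => absurd h hx⟩
  choose ψ hψ using hlim
  have hψG : ∀ x ∈ petal a M (k / 2) (ρ / 2), ∀ n, ‖T^[n] 0 x - ψ x‖ ≤ G n := by
    intro x hx n
    have h1 : Tendsto (fun i => ‖T^[n] 0 x - T^[n + i] 0 x‖) atTop (𝓝 ‖T^[n] 0 x - ψ x‖) := by
      have := (hψ x hx).comp (tendsto_add_atTop_nat n)
      simp only [Function.comp_def, add_comm _ n] at this
      exact (tendsto_const_nhds.sub this).norm
    exact le_of_tendsto' h1 (hdist x hx n)
  have hunif : TendstoUniformlyOn (fun n => T^[n] 0) ψ atTop (petal a M (k / 2) (ρ / 2)) := by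
    rw [Metric.tendstoUniformlyOn_iff]
    intro e he
    filter_upwards [hG.eventually_lt_const he] with n hn x hx
    rw [dist_comm, dist_eq_norm]
    exact (hψG x hx n).trans_lt hn
  have hbound : ∀ x ∈ petal a M (k / 2) (ρ / 2), ‖ψ x‖ ≤ graphSlope a c * ‖x‖ := fun x hx =>
    le_of_tendsto' (hψ x hx).norm fun n => (hcone n).2 x (hsub hx)
  have hstep : ∀ x ∈ petal a M (k / 2) (ρ / 2), ∀ y, (x, y) ∈ Metric.ball (0 : ℂ × ℂ) r →
      (F (x, y)).1 ∈ petal a M (k / 2) (ρ / 2) := fun x hx y hy =>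
    h.fst_mem_petal hy le_rfl (by linarith) hx
  refine ⟨ψ, ⟨?_, hbound⟩, ?_, ?_⟩
  · exact hunif.tendstoLocallyUniformlyOn.differentiableOn
      (Eventually.of_forall fun n => (hcone n).1.mono hsub) (isOpen_petal _ _ _ _)
  · intro x hx
    have hb := hball x hx _ (hbound x hx)
    have hbn := fun n => hball x hx _ ((hcone n).2 x (hsub hx))
    rw [← sub_eq_zero, ← norm_le_zero_iff]
    -- The invariance defect of `ψ` is compared with the recursion for the iterates; the four
    -- differences are bounded by `G`, which tends to 0.
    have hlim0 : Tendsto (fun n => ‖1 + b * x ^ M‖ * G (n + 1) + 2 * (ε * ‖x‖ ^ M) * G n + G n)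
        atTop (𝓝 0) := by
      have h1 := (hG.comp (tendsto_add_atTop_nat 1)).const_mul ‖1 + b * x ^ M‖
      have h2 := hG.const_mul (2 * (ε * ‖x‖ ^ M))
      simpa [Function.comp_def] using (h1.add h2).add hG
    refine ge_of_tendsto' hlim0 fun n => ?_
    have e1 : T^[n + 1] 0 x * (1 + b * x ^ M) =
        T^[n] 0 (F (x, T^[n] 0 x)).1 - x ^ M * (c * x + B (x, T^[n] 0 x)) := by
      rw [Function.iterate_succ_apply', hT, graphTransform,
        div_mul_cancel₀ _ (h.one_add_ne_zero (hsub hx).1)]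
    have e2 : (F (x, ψ x)).2 - ψ (F (x, ψ x)).1 =
        (1 + b * x ^ M) * (ψ x - T^[n + 1] 0 x) + x ^ M * (B (x, ψ x) - B (x, T^[n] 0 x))
        + (T^[n] 0 (F (x, T^[n] 0 x)).1 - T^[n] 0 (F (x, ψ x)).1)
        + (T^[n] 0 (F (x, ψ x)).1 - ψ (F (x, ψ x)).1) := by
      rw [h.snd_eq hb]
      linear_combination e1
    rw [e2]
    have n1 : ‖(1 + b * x ^ M) * (ψ x - T^[n + 1] 0 x)‖ ≤ ‖1 + b * x ^ M‖ * G (n + 1) := by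
      rw [norm_mul, norm_sub_rev (ψ x)]
      gcongr
      exact hψG x hx (n + 1)
    have n2 : ‖x ^ M * (B (x, ψ x) - B (x, T^[n] 0 x))‖ ≤ ε * ‖x‖ ^ M * G n := by
      rw [norm_mul, norm_pow]
      calc _ ≤ ‖x‖ ^ M * (ε * ‖ψ x - T^[n] 0 x‖) := by
            gcongr
            exact h.norm_B_sub_le hb (hbn n)
        _ ≤ ‖x‖ ^ M * (ε * G n) := by
            gcongr
            rw [norm_sub_rev]
            exact hψG x hx n
        _ = _ := by ring
    have n3 : ‖T^[n] 0 (F (x, T^[n] 0 x)).1 - T^[n] 0 (F (x, ψ x)).1‖ ≤ ε * ‖x‖ ^ M * G n :=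
      (h.norm_comp_fst_sub_le hρC (hcone n) hx (hbn n) hb).trans
        (by gcongr; exact hψG x hx n)
    have n4 := hψG _ (hstep x hx _ hb) n
    refine (norm_add_le _ _).trans ?_
    have := (norm_add_le ((1 + b * x ^ M) * (ψ x - T^[n + 1] 0 x) +
      x ^ M * (B (x, ψ x) - B (x, T^[n] 0 x)))
      (T^[n] 0 (F (x, T^[n] 0 x)).1 - T^[n] 0 (F (x, ψ x)).1))
    have := norm_add_le ((1 + b * x ^ M) * (ψ x - T^[n + 1] 0 x))
      (x ^ M * (B (x, ψ x) - B (x, T^[n] 0 x)))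
    linarith
  · intro x hx y y' hy hy'
    exact le_of_tendsto' ((hψ _ (hstep x hx y hy)).sub (hψ _ (hstep x hx y' hy'))).norm
      fun n => h.norm_comp_fst_sub_le hρC (hcone n) hx hy hy'

/-- An orbit which starts over a petal and does not leave the polydisc lies on the invariant
graph. -/
theorem snd_eq_of_forall_iterate_mem (h : SaddleEstimates F M a b c A B k κ C ε r)
    (hρ : ρ * (1 + graphSlope a c) ≤ r) {ψ : ℂ → ℂ} (hψ : IsConeGraph a M c (k / 2) ρ ψ)
    (hinv : ∀ x ∈ petal a M (k / 2) ρ, (F (x, ψ x)).2 = ψ (F (x, ψ x)).1)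
    (hlip : ∀ x ∈ petal a M (k / 2) ρ, ∀ y y', (x, y) ∈ Metric.ball (0 : ℂ × ℂ) r →
      (x, y') ∈ Metric.ball (0 : ℂ × ℂ) r →
      ‖ψ (F (x, y)).1 - ψ (F (x, y')).1‖ ≤ ε * ‖x‖ ^ M * ‖y - y'‖)
    {p : ℂ × ℂ} (hp : ∀ n, F^[n] p ∈ Metric.ball (0 : ℂ × ℂ) r)
    (hx : p.1 ∈ petal a M (k / 2) ρ) : p.2 = ψ p.1 := by
  by_contra hne
  have hK := h.graphSlope_pos
  have hk := h.k_pos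
  have ha := h.norm_a_pos
  have hM := h.M_pos
  have hε := h.ε_pos
  have hpet : ∀ n, (F^[n] p).1 ∈ petal a M (k / 2) ρ := by
    intro n
    induction n with
    | zero => exact hx
    | succ n ih =>
      rw [Function.iterate_succ_apply']
      exact h.fst_mem_petal (hp n) le_rfl (by linarith) ih
  have hx0 : ∀ n, (F^[n] p).1 ≠ 0 := fun n => h.ne_zero_of_mem_petal (hpet n)
  have hball : ∀ n, ((F^[n] p).1, ψ (F^[n] p).1) ∈ Metric.ball (0 : ℂ × ℂ) r := fun n =>
    mk_mem_ball hK.le hρ (hpet n).2 (hψ.2 _ (hpet n))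
  have hu0 : ∀ n, (petalCoord a M (F^[n] p).1)⁻¹ ≠ 0 := fun n =>
    inv_ne_zero (ne_zero_of_mem_sector (hpet n).1)
  obtain ⟨n, hn⟩ : ∃ n, r + r < ‖(F^[n] p).2 - ψ (F^[n] p).1‖ := by
    -- The distance to the graph gains `4ε‖x‖^M` and loses `ε‖x‖^M` twice, to `B` and to the shift
    -- of the base point. The net `2ε‖x‖^M` equals `δ / t n` for this `δ`.
    refine unbounded_of_growth (t := fun n => ‖(petalCoord a M (F^[n] p).1)⁻¹‖) (S := 2)
      (δ := 2 * ε / (‖a‖ * M)) (d := fun n => ‖(F^[n] p).2 - ψ (F^[n] p).1‖)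
      (by positivity) (by norm_num) (fun n => norm_pos_iff.2 (hu0 n)) (fun n => ?_)
      (norm_pos_iff.2 (sub_ne_zero.2 hne)) (fun n => ?_) (r + r)
    · have h3 := (h.drift _ (hp n)).2 (hx0 n)
      rw [← Function.iterate_succ_apply' F] at h3
      have h1 := norm_sub_norm_le ((petalCoord a M (F^[n + 1] p).1)⁻¹
        - (petalCoord a M (F^[n] p).1)⁻¹) 1
      have h2 := norm_sub_norm_le (petalCoord a M (F^[n + 1] p).1)⁻¹
        (petalCoord a M (F^[n] p).1)⁻¹
      rw [norm_one] at h1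
      have := h.k_le
      linarith
    · simp only [Function.iterate_succ_apply']
      have hpn := hp n
      have hqn := hball n
      have hptn := hpet n
      generalize F^[n] p = q at hpn hqn hptn
      have h1 := h.one_add_le_norm (sector_mono (by linarith) (by linarith) hptn.1)
      have h2 := hlip _ hptn _ _ hpn hqn
      have h3 := h.norm_B_sub_le (y := q.2) hpn hqn
      have e : (F q).2 - ψ (F q).1 = (1 + b * q.1 ^ M) * (q.2 - ψ q.1)
          + q.1 ^ M * (B q - B (q.1, ψ q.1)) - (ψ (F q).1 - ψ (F (q.1, ψ q.1)).1) := by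
        have e1 := hinv _ hptn
        rw [h.snd_eq hqn] at e1
        rw [h.snd_eq hpn, ← e1]
        ring
      rw [e]
      have h4 : ‖q.1 ^ M * (B q - B (q.1, ψ q.1))‖ ≤ ε * ‖q.1‖ ^ M * ‖q.2 - ψ q.1‖ := by
        rw [norm_mul, norm_pow]
        calc _ ≤ ‖q.1‖ ^ M * (ε * ‖q.2 - ψ q.1‖) := by gcongr
          _ = _ := by ring
      have h5 := norm_sub_norm_le ((1 + b * q.1 ^ M) * (q.2 - ψ q.1)
          + q.1 ^ M * (B q - B (q.1, ψ q.1))) (ψ (F q).1 - ψ (F (q.1, ψ q.1)).1)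
      have h6 := norm_sub_le_norm_add ((1 + b * q.1 ^ M) * (q.2 - ψ q.1))
        (q.1 ^ M * (B q - B (q.1, ψ q.1)))
      have h7 : (1 + 4 * ε * ‖q.1‖ ^ M) * ‖q.2 - ψ q.1‖ ≤
          ‖(1 + b * q.1 ^ M) * (q.2 - ψ q.1)‖ := by
        rw [norm_mul]; gcongr
      have h8 : 2 * ε / (‖a‖ * M) / ‖(petalCoord a M q.1)⁻¹‖ = 2 * ε * ‖q.1‖ ^ M := by
        rw [norm_inv, norm_petalCoord, div_inv_eq_mul]
        field_simp
      rw [h8]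
      simp only [Prod.mk.eta] at h2
      linarith
  have h1 := mem_ball_zero_iff.1 (hp n)
  have h2 := mem_ball_zero_iff.1 (hball n)
  have h3 := (norm_snd_le (F^[n] p)).trans_lt h1
  have h4 := (norm_snd_le ((F^[n] p).1, ψ (F^[n] p).1)).trans_lt h2
  have h5 := norm_sub_le (F^[n] p).2 (ψ (F^[n] p).1)
  simp only at h4
  linarith

end SaddleEstimates

/-! ### From the invariant graph to parabolic curves -/

/-- Holomorphic functions over the petals whose graph is invariant under `F`. -/
structure IsInvariantGraph (F : ℂ × ℂ → ℂ × ℂ) (a : ℂ) (M : ℕ) (c : ℂ) (k ε r ρ : ℝ)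
    (ψ : ℂ → ℂ) : Prop where
  cone : IsConeGraph a M c k ρ ψ
  inv : ∀ x ∈ petal a M k ρ, (F (x, ψ x)).2 = ψ (F (x, ψ x)).1
  lip : ∀ x ∈ petal a M k ρ, ∀ y y', (x, y) ∈ Metric.ball (0 : ℂ × ℂ) r →
    (x, y') ∈ Metric.ball (0 : ℂ × ℂ) r →
    ‖ψ (F (x, y)).1 - ψ (F (x, y')).1‖ ≤ ε * ‖x‖ ^ M * ‖y - y'‖

theorem IsInvariantGraph.mono {F : ℂ × ℂ → ℂ × ℂ} {a : ℂ} {M : ℕ} {c : ℂ} {k ε r ρ ρ' : ℝ}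
    {ψ : ℂ → ℂ} (h : IsInvariantGraph F a M c k ε r ρ ψ) (hk : 0 < k) (hρ : ρ' ≤ ρ) :
    IsInvariantGraph F a M c k ε r ρ' ψ where
  cone := ⟨h.cone.1.mono (petal_mono hk le_rfl hρ),
    fun x hx => h.cone.2 x (petal_mono hk le_rfl hρ hx)⟩
  inv x hx := h.inv x (petal_mono hk le_rfl hρ hx)
  lip x hx := h.lip x (petal_mono hk le_rfl hρ hx)

theorem SaddleEstimates.exists_isInvariantGraph {F : ℂ × ℂ → ℂ × ℂ} {M : ℕ} {a b c : ℂ}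
    {A B : ℂ × ℂ → ℂ} {k κ C ε r : ℝ} (h : SaddleEstimates F M a b c A B k κ C ε r) :
    ∃ ρ > 0, ∃ ψ, IsInvariantGraph F a M c (k / 2) ε r ρ ψ := by
  have hK := h.graphSlope_pos
  have hκ := h.κ_pos
  have hC := h.C_nonneg
  have hε := h.ε_pos
  have hr := h.r_pos
  set D := 2 * graphSlope a c / κ * C with hD
  have hD0 : 0 ≤ D := by positivity
  have e1 : min (r / (1 + graphSlope a c)) (ε / (D + 1)) * (1 + graphSlope a c) ≤ r :=
    calc _ ≤ r / (1 + graphSlope a c) * (1 + graphSlope a c) := by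
          gcongr; exact min_le_left _ _
      _ = r := by field_simp
  have e2 : min (r / (1 + graphSlope a c)) (ε / (D + 1)) * D ≤ ε :=
    calc _ ≤ ε / (D + 1) * D := by gcongr; exact min_le_right _ _
      _ ≤ ε / (D + 1) * (D + 1) := by gcongr; linarith
      _ = ε := by field_simp
  obtain ⟨ψ, h1, h2, h3⟩ := h.exists_invariant_graph e1 e2
  exact ⟨_, by positivity, ψ, h1, h2, h3⟩

/-- Near the right half-plane the principal `M`-th root commutes with multiplication by
`(1 + w)^M`, `w` small. -/
theorem exists_cpow_inv_mul (M : ℕ) (hM : M ≠ 0) : ∃ η > 0, ∀ ζ w : ℂ, 0 < ζ.re → ‖w‖ < η →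
    (ζ * (1 + w) ^ M) ^ ((M : ℂ)⁻¹) = ζ ^ ((M : ℂ)⁻¹) * (1 + w) := by
  have hMpos : (0 : ℝ) < M := by exact_mod_cast Nat.pos_of_ne_zero hM
  have hMC : (M : ℂ) ≠ 0 := by exact_mod_cast hM
  have e1 : ContinuousAt (fun w : ℂ => |(Complex.log (1 + w)).im|) 0 := by
    have : ContinuousAt (fun w : ℂ => Complex.log (1 + w)) 0 :=
      ContinuousAt.clog (by fun_prop) (by simp)
    exact (Complex.continuous_im.continuousAt.comp this).abs
  have e2 : ∀ᶠ w in 𝓝 (0 : ℂ), |(Complex.log (1 + w)).im| < Real.pi / 2 / M :=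
    e1.eventually_lt_const (by simpa using by positivity)
  have e3 : ∀ᶠ w in 𝓝 (0 : ℂ), 1 + w ≠ 0 :=
    (by fun_prop : ContinuousAt (fun w : ℂ => 1 + w) 0).eventually_ne (by simp)
  obtain ⟨η, hη, H⟩ := Metric.eventually_nhds_iff_ball.1 (e2.and e3)
  refine ⟨η, hη, fun ζ w hζ hw => ?_⟩
  obtain ⟨h1, h2⟩ := H w (by simpa using hw)
  have hζ0 : ζ ≠ 0 := by rintro rfl; simp at hζ
  have hζi : |(Complex.log ζ).im| < Real.pi / 2 := by
    rw [Complex.log_im, Complex.abs_arg_lt_pi_div_two_iff]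
    exact Or.inl hζ
  have hMi : |M * (Complex.log (1 + w)).im| < Real.pi / 2 := by
    rwa [abs_mul, abs_of_pos hMpos, mul_comm, ← lt_div_iff₀ hMpos]
  -- Both imaginary parts are below `π / 2` in modulus, so their sum stays within the principal
  -- branch.
  have hlog : Complex.log (ζ * (1 + w) ^ M) = Complex.log ζ + M * Complex.log (1 + w) := by
    have him : (Complex.log ζ + M * Complex.log (1 + w)).im =
        (Complex.log ζ).im + M * (Complex.log (1 + w)).im := by
      rw [Complex.add_im, ← Complex.ofReal_natCast, Complex.im_ofReal_mul]
    rw [abs_lt] at hζi hMi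
    rw [← Complex.log_exp (x := Complex.log ζ + M * Complex.log (1 + w)) (by rw [him]; linarith)
      (by rw [him]; linarith), Complex.exp_add, Complex.exp_log hζ0, Complex.exp_nat_mul,
      Complex.exp_log h2]
  rw [Complex.cpow_def_of_ne_zero (mul_ne_zero hζ0 (pow_ne_zero _ h2)), hlog,
    Complex.cpow_def_of_ne_zero hζ0, add_mul, Complex.exp_add, mul_comm (M : ℂ), mul_assoc,
    mul_inv_cancel₀ hMC, mul_one, Complex.exp_log h2]

namespace SaddleEstimates

variable {F : ℂ × ℂ → ℂ × ℂ} {M : ℕ} {a b c : ℂ} {A B : ℂ × ℂ → ℂ}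
  {k κ C ε r ρ : ℝ} {ψ : ℂ → ℂ}

theorem graph_mem_ball (h : SaddleEstimates F M a b c A B k κ C ε r)
    (hψ : IsInvariantGraph F a M c (k / 2) ε r ρ ψ) {s : ℝ} (hρ : ρ * (1 + graphSlope a c) ≤ s)
    {x : ℂ} (hx : x ∈ petal a M (k / 2) ρ) : (x, ψ x) ∈ Metric.ball (0 : ℂ × ℂ) s :=
  mk_mem_ball h.graphSlope_pos.le hρ hx.2 (hψ.cone.2 x hx)

/-- The dynamics on the invariant graph. -/
theorem iterate_graph (h : SaddleEstimates F M a b c A B k κ C ε r)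
    (hψ : IsInvariantGraph F a M c (k / 2) ε r ρ ψ) (hρ : ρ * (1 + graphSlope a c) ≤ r)
    {x : ℂ} (hx : x ∈ petal a M (k / 2) ρ) (n : ℕ) :
    (F^[n] (x, ψ x)).1 ∈ petal a M (k / 2) ρ ∧ (F^[n] (x, ψ x)).2 = ψ (F^[n] (x, ψ x)).1 ∧
      ‖a‖ / 4 * n ≤ (‖(F^[n] (x, ψ x)).1‖ ^ M)⁻¹ := by
  have hk := h.k_pos
  induction n with
  | zero => exact ⟨hx, rfl, by simp⟩
  | succ n ih =>
    obtain ⟨h1, h2, h3⟩ := ih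
    rw [Function.iterate_succ_apply']
    generalize F^[n] (x, ψ x) = q at h1 h2 h3
    have hq : q = (q.1, ψ q.1) := Prod.ext rfl h2
    have hb : q ∈ Metric.ball (0 : ℂ × ℂ) r := by
      rw [hq]; exact h.graph_mem_ball hψ hρ h1
    refine ⟨h.fst_mem_petal hb le_rfl (by linarith) h1, ?_, ?_⟩
    · rw [hq]; exact hψ.inv _ h1
    · have := h.inv_pow_add_le hb (sector_mono (by linarith) (by linarith) h1.1)
      push_cast
      linarith

theorem norm_graph_le (h : SaddleEstimates F M a b c A B k κ C ε r)
    (hψ : IsInvariantGraph F a M c (k / 2) ε r ρ ψ) {x : ℂ} (hx : x ∈ petal a M (k / 2) ρ) :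
    ‖(x, ψ x)‖ ≤ (1 + graphSlope a c) * ‖x‖ := by
  have h1 := hψ.cone.2 x hx
  have h2 := h.graphSlope_pos
  have h3 := norm_nonneg x
  rw [Prod.norm_def, max_le_iff]
  constructor <;> simp only <;> nlinarith

/-- Every point of the invariant graph lies on a parabolic curve. -/
theorem exists_isParabolicCurve {F : OpenPartialHomeomorph (ℂ × ℂ) (ℂ × ℂ)}
    (h : SaddleEstimates F M a b c A B k κ C ε r)
    (hκ : ∀ ζ w : ℂ, 0 < ζ.re → ‖w‖ < κ →
      (ζ * (1 + w) ^ M) ^ ((M : ℂ)⁻¹) = ζ ^ ((M : ℂ)⁻¹) * (1 + w))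
    (hψ : IsInvariantGraph F a M c (k / 2) ε r ρ ψ) (hρ0 : 0 < ρ)
    (hρ : ρ * (1 + graphSlope a c) ≤ r)
    (hsrc : ∀ x ∈ petal a M (k / 2) ρ, (x, ψ x) ∈ F.source)
    {x₀ : ℂ} (hx₀ : x₀ ∈ petal a M (k / 2) ρ) :
    ∃ S, IsParabolicCurve F S ∧ (x₀, ψ x₀) ∈ S := by
  have hk : 0 < k / 2 := by linarith [h.k_pos]
  have ha := h.norm_a_pos
  have hM := h.M_pos
  have hK := h.graphSlope_pos
  have hMC : (M : ℂ) ≠ 0 := by exact_mod_cast h.hM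
  set ζ₀ := petalCoord a M x₀ with hζ₀
  have hζ₀0 : ζ₀ ≠ 0 := ne_zero_of_mem_sector hx₀.1
  -- `ω` selects the branch of the `M`-th root through `x₀`. Then `ζ ↦ ω ζ^(1/M)` is a section of
  -- `petalCoord`, which gives injectivity at once.
  set ω := x₀ / ζ₀ ^ ((M : ℂ)⁻¹) with hω
  have hroot0 : ∀ ζ : ℂ, ζ ≠ 0 → ζ ^ ((M : ℂ)⁻¹) ≠ 0 := fun ζ hζ => by
    simp [Complex.cpow_eq_zero_iff, hζ]
  have hx₀ω : ω * ζ₀ ^ ((M : ℂ)⁻¹) = x₀ := div_mul_cancel₀ _ (hroot0 _ hζ₀0)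
  have hω1 : petalCoord a M ω = 1 := by
    have h1 : petalCoord a M ω * ζ₀ = ζ₀ := by
      conv_lhs => rw [← Complex.cpow_nat_inv_pow ζ₀ h.hM]
      rw [← petalCoord_mul, hx₀ω]
    exact mul_right_cancel₀ hζ₀0 (by rw [h1, one_mul])
  let e : ℂ → ℂ := fun ζ => ω * ζ ^ ((M : ℂ)⁻¹)
  have he : ∀ ζ, petalCoord a M (e ζ) = ζ := fun ζ => by
    simp only [e]
    rw [petalCoord_mul, hω1, one_mul, Complex.cpow_nat_inv_pow ζ h.hM]
  set τ := ‖a‖ * M * ρ ^ M with hτ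
  let Δ : Set ℂ := sector (k / 2) ∩ Metric.ball 0 τ
  have hlt : ∀ x : ℂ, ‖petalCoord a M x‖ < τ ↔ ‖x‖ < ρ := by
    intro x
    rw [norm_petalCoord, hτ, mul_lt_mul_iff_right₀ (by positivity),
      pow_lt_pow_iff_left₀ (norm_nonneg _) hρ0.le h.hM]
  have hΔpet : ∀ x, petalCoord a M x ∈ Δ ↔ x ∈ petal a M (k / 2) ρ := by
    intro x
    simp only [Δ, mem_inter_iff, mem_ball_zero_iff, hlt]
    exact Iff.rfl
  have hepet : ∀ ζ ∈ Δ, e ζ ∈ petal a M (k / 2) ρ := fun ζ hζ => by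
    rw [← hΔpet, he]; exact hζ
  have hΔo : IsOpen Δ := (isOpen_sector _).inter Metric.isOpen_ball
  have hΔc : Convex ℝ Δ := (convex_sector _).inter (convex_ball _ _)
  have hζ₀Δ : ζ₀ ∈ Δ := (hΔpet x₀).2 hx₀
  have hbound : ∀ ζ ∈ Δ, ‖(e ζ, ψ (e ζ))‖ ≤ (1 + graphSlope a c) * ‖e ζ‖ := fun ζ hζ =>
    h.norm_graph_le hψ (hepet ζ hζ)
  have hball : ∀ x ∈ petal a M (k / 2) ρ, (x, ψ x) ∈ Metric.ball (0 : ℂ × ℂ) r := fun x hx =>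
    h.graph_mem_ball hψ hρ hx
  refine ⟨(fun ζ => (e ζ, ψ (e ζ))) '' Δ, ⟨Δ, fun ζ => (e ζ, ψ (e ζ)), hΔo, ?_, ?_, ?_, ?_, ?_, ?_,
    rfl, ?_, ?_, ?_⟩, ⟨ζ₀, hζ₀Δ, ?_⟩⟩
  -- In the petal coordinate the domain is a sector cut by a disc, hence convex.
  · have := hΔc.contractibleSpace ⟨ζ₀, hζ₀Δ⟩
    exact SimplyConnectedSpace.ofContractible Δ
  · rw [hΔo.frontier_eq]
    refine ⟨?_, fun h0 => ne_zero_of_mem_sector h0.1 rfl⟩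
    have ht : Tendsto (fun n : ℕ => (1 / ((n : ℝ) + 1)) • ζ₀) atTop (𝓝 0) := by
      simpa using (tendsto_one_div_add_atTop_nhds_zero_nat (𝕜 := ℝ)).smul_const ζ₀
    refine mem_closure_of_tendsto ht (Eventually.of_forall fun n => ?_)
    have hn : 0 < 1 / ((n : ℝ) + 1) := by positivity
    have hn1 : 1 / ((n : ℝ) + 1) ≤ 1 := by
      rw [div_le_one (by positivity)]
      have : (0 : ℝ) ≤ n := n.cast_nonneg
      linarith
    generalize 1 / ((n : ℝ) + 1) = t at hn hn1
    constructor
    · have h1 : |ζ₀.im| < k / 2 * ζ₀.re := hx₀.1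
      change |(t • ζ₀).im| < k / 2 * (t • ζ₀).re
      simp only [Complex.smul_im, Complex.smul_re, smul_eq_mul, abs_mul, abs_of_pos hn]
      nlinarith
    · have h1 := mem_ball_zero_iff.1 hζ₀Δ.2
      rw [mem_ball_zero_iff, norm_smul, Real.norm_of_nonneg hn.le]
      have := norm_nonneg ζ₀
      nlinarith
  · intro ζ hζ
    have h1 : AnalyticAt ℂ e ζ := analyticAt_const.mul
      (analyticAt_id.cpow analyticAt_const (Or.inl (re_pos_of_mem_sector hk hζ.1)))
    have h2 : AnalyticAt ℂ ψ (e ζ) :=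
      hψ.cone.1.analyticAt ((isOpen_petal a M (k / 2) ρ).mem_nhds (hepet ζ hζ))
    exact h1.prod (h2.fun_comp h1)
  · intro ζ _ ζ' _ heq
    rw [← he ζ, ← he ζ']
    exact congrArg (petalCoord a M) (Prod.ext_iff.1 heq).1
  · intro ζ hζ heq
    exact h.ne_zero_of_mem_petal (hepet ζ hζ) (Prod.ext_iff.1 heq).1
  · have h1 : Tendsto e (𝓝 0) (𝓝 0) := by
      have h2 : ContinuousAt e 0 := continuousAt_const.mul
        (Complex.continuousAt_cpow_const_of_re_pos (by simp) (by
          rw [← Complex.ofReal_natCast, ← Complex.ofReal_inv, Complex.ofReal_re]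
          positivity))
      simpa [ContinuousAt, e, hMC] using h2
    have h2 : Tendsto (fun ζ => (1 + graphSlope a c) * ‖e ζ‖) (𝓝[Δ] 0) (𝓝 0) := by
      simpa using (h1.mono_left nhdsWithin_le_nhds).norm.const_mul (1 + graphSlope a c)
    exact squeeze_zero_norm' (eventually_nhdsWithin_of_forall hbound) h2
  · rintro _ ⟨ζ, hζ, rfl⟩
    exact hsrc _ (hepet ζ hζ)
  · rintro _ ⟨ζ, hζ, rfl⟩
    have hpet := hepet ζ hζ
    have hb := hball _ hpet
    obtain ⟨i1, i2, -⟩ := h.iterate_graph hψ hρ hpet 1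
    rw [Function.iterate_one] at i1 i2
    have hw := h.w_lt _ hb
    have hfst := h.fst_eq hb
    simp only at hw hfst
    generalize (e ζ) ^ M * (a + A (e ζ, ψ (e ζ))) = w at hw hfst
    have h3 : petalCoord a M (F (e ζ, ψ (e ζ))).1 = ζ * (1 + w) ^ M := by
      rw [hfst, petalCoord_mul, he]
    -- The image stays on the same branch of the root, so this single curve is invariant, not just
    -- the union over all petals.
    have h4 : e (ζ * (1 + w) ^ M) = (F (e ζ, ψ (e ζ))).1 := by
      simp only [e] at hfst ⊢
      rw [hκ ζ w (re_pos_of_mem_sector hk hζ.1) hw, hfst, mul_assoc]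
    refine ⟨ζ * (1 + w) ^ M, ?_, ?_⟩
    · rw [← h3, hΔpet]; exact i1
    · simp only [h4]
      exact Prod.ext rfl i2.symm
  · intro T hT _
    rw [Metric.tendstoUniformlyOn_iff]
    intro δ hδ
    set δ' := δ / (1 + graphSlope a c) with hδ'
    have hδ'0 : 0 < δ' := by positivity
    have h1 : Tendsto (fun n : ℕ => ‖a‖ / 4 * (n : ℝ)) atTop atTop :=
      tendsto_natCast_atTop_atTop.const_mul_atTop (by positivity)
    filter_upwards [h1.eventually_gt_atTop (δ' ^ M)⁻¹] with n hn ζ hζ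
    obtain ⟨i1, i2, i3⟩ := h.iterate_graph hψ hρ (hepet ζ (hT hζ)) n
    rw [dist_zero_left]
    generalize F^[n] (e ζ, ψ (e ζ)) = q at i1 i2 i3
    have hq : q = (q.1, ψ q.1) := Prod.ext rfl i2
    have hq0 : 0 < ‖q.1‖ := norm_pos_iff.2 (h.ne_zero_of_mem_petal i1)
    have h5 : ‖q.1‖ ^ M < δ' ^ M := by
      rw [← inv_lt_inv₀ (by positivity) (by positivity)]
      exact hn.trans_le i3
    have h6 : ‖q.1‖ < δ' := lt_of_pow_lt_pow_left₀ M hδ'0.le h5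
    rw [hq]
    refine (h.norm_graph_le hψ i1).trans_lt ?_
    rw [hδ', lt_div_iff₀ (by positivity)] at h6
    linarith
  · simp only [e, hx₀ω]

end SaddleEstimates

/-! ### The attracted set and its submanifold structure -/

/-- A constant orbit tending to 0 would be the origin, which a parabolic curve avoids. -/
theorem IsParabolicCurve.ne_of_mem {F : OpenPartialHomeomorph (ℂ × ℂ) (ℂ × ℂ)} {S : Set (ℂ × ℂ)}
    (hS : IsParabolicCurve F S) {p : ℂ × ℂ} (hp : p ∈ S) : F p ≠ p := by
  obtain ⟨Δ, φ, -, -, -, -, -, hφ0, -, rfl, -, -, hunif⟩ := hS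
  obtain ⟨ζ, hζ, rfl⟩ := hp
  intro hfix
  have h1 := (hunif {ζ} (by simpa using hζ) isCompact_singleton).tendsto_at (mem_singleton ζ)
  have h2 : ∀ j : ℕ, F^[j] (φ ζ) = φ ζ := fun j => Function.iterate_fixed hfix j
  simp only [h2] at h1
  exact hφ0 ζ hζ (tendsto_nhds_unique tendsto_const_nhds h1)

theorem IsParabolicCurve.mapsTo {F : OpenPartialHomeomorph (ℂ × ℂ) (ℂ × ℂ)} {S : Set (ℂ × ℂ)}
    (hS : IsParabolicCurve F S) : MapsTo F S S := by
  obtain ⟨Δ, φ, -, -, -, -, -, -, -, -, -, h, -⟩ := hS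
  exact h

theorem mem_attractedSet_iff_apply {F : OpenPartialHomeomorph (ℂ × ℂ) (ℂ × ℂ)} {U : Set (ℂ × ℂ)}
    {p : ℂ × ℂ} (hp : p ∈ U) : p ∈ attractedSet F U ↔ F p ∈ attractedSet F U := by
  constructor
  · rintro ⟨h, S, hS, j, hj⟩
    refine ⟨fun i => by rw [← Function.iterate_succ_apply]; exact h (i + 1), S, hS, j, ?_⟩
    rw [← Function.iterate_succ_apply, Function.iterate_succ_apply']
    exact hS.mapsTo hj
  · rintro ⟨h, S, hS, j, hj⟩
    refine ⟨fun i => ?_, S, hS, j + 1, by rwa [Function.iterate_succ_apply]⟩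
    cases i with
    | zero => exact hp
    | succ i => rw [Function.iterate_succ_apply]; exact h i

/-- `P` is, near `p`, the zero set in `U` of a holomorphic function without critical points. -/
def IsCutOutAt (P U : Set (ℂ × ℂ)) (p : ℂ × ℂ) : Prop :=
  ∃ (W : Set (ℂ × ℂ)) (g : ℂ × ℂ → ℂ), IsOpen W ∧ p ∈ W ∧ W ⊆ U ∧
    AnalyticOnNhd ℂ g W ∧ (∀ q ∈ W, fderiv ℂ g q ≠ 0) ∧ P ∩ W = {q ∈ W | g q = 0}

theorem IsBiholomorphismAtZero.fderiv_comp_ne_zero {F : OpenPartialHomeomorph (ℂ × ℂ) (ℂ × ℂ)}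
    (hF : IsBiholomorphismAtZero F) {g : ℂ × ℂ → ℂ} {p : ℂ × ℂ} (hp : p ∈ F.source)
    (hg : AnalyticAt ℂ g (F p)) (hg0 : fderiv ℂ g (F p) ≠ 0) :
    fderiv ℂ (fun q => g (F q)) p ≠ 0 := by
  intro h0
  apply hg0
  have hFp := F.map_source hp
  have e : g =ᶠ[𝓝 (F p)] (fun q => g (F q)) ∘ F.symm := by
    filter_upwards [F.open_target.mem_nhds hFp] with q hq
    simp [F.right_inv hq]
  have h1 : DifferentiableAt ℂ (fun q => g (F q)) (F.symm (F p)) := by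
    rw [F.left_inv hp]
    exact (hg.fun_comp (hF.2.2.1 p hp)).differentiableAt
  rw [e.fderiv_eq, fderiv_comp _ h1 (hF.2.2.2 _ hFp).differentiableAt, F.left_inv hp, h0,
    ContinuousLinearMap.zero_comp]

/-- Compose the local equation with `F`: within `U` the attracted set is its own preimage, and a
biholomorphism keeps the differential nonzero. -/
theorem IsCutOutAt.of_apply {F : OpenPartialHomeomorph (ℂ × ℂ) (ℂ × ℂ)}
    (hF : IsBiholomorphismAtZero F) {U : Set (ℂ × ℂ)} (hU : IsOpen U) (hUs : U ⊆ F.source)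
    {p : ℂ × ℂ} (hp : p ∈ U) (h : IsCutOutAt (attractedSet F U) U (F p)) :
    IsCutOutAt (attractedSet F U) U p := by
  obtain ⟨W, g, hW, hpW, -, hg, hg0, hPW⟩ := h
  refine ⟨U ∩ F ⁻¹' W, fun q => g (F q), (F.continuousOn.mono hUs).isOpen_inter_preimage hU hW,
    ⟨hp, hpW⟩, inter_subset_left, ?_, ?_, ?_⟩
  · exact fun q hq => (hg _ hq.2).fun_comp (hF.2.2.1 q (hUs hq.1))
  · exact fun q hq => hF.fderiv_comp_ne_zero (hUs hq.1) (hg _ hq.2) (hg0 _ hq.2)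
  · ext q
    have h1 := Set.ext_iff.1 hPW (F q)
    simp only [mem_inter_iff, mem_ofPred_eq, mem_preimage] at h1 ⊢
    constructor
    · rintro ⟨h2, h3, h4⟩
      exact ⟨⟨h3, h4⟩, (h1.1 ⟨(mem_attractedSet_iff_apply h3).1 h2, h4⟩).2⟩
    · rintro ⟨⟨h3, h4⟩, h5⟩
      exact ⟨(mem_attractedSet_iff_apply h3).2 (h1.2 ⟨h4, h5⟩).1, h3, h4⟩

namespace SaddleEstimates

variable {F : OpenPartialHomeomorph (ℂ × ℂ) (ℂ × ℂ)} {M : ℕ} {a b c : ℂ} {A B : ℂ × ℂ → ℂ}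
  {k κ C ε r ρ s : ℝ} {ψ : ℂ → ℂ}

theorem apply_eq_self_iff (h : SaddleEstimates F M a b c A B k κ C ε r) {p : ℂ × ℂ}
    (hp : p ∈ Metric.ball (0 : ℂ × ℂ) r) : F p = p ↔ p.1 = 0 := by
  have hA := h.A_le p hp
  have ha := h.norm_a_pos
  have hne : a + A p ≠ 0 := by
    intro h0
    have : ‖a‖ = ‖A p‖ := by rw [eq_neg_of_add_eq_zero_left h0, norm_neg]
    linarith
  have hM := h.hM
  rw [h.form p hp, Prod.ext_iff]
  constructor
  · rintro ⟨h1, -⟩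
    simpa [hne] using h1
  · intro h1
    simp [h1, hM]

/-- Orbits which do not leave the polydisc eventually enter the petals. -/
theorem exists_iterate_mem_petal (h : SaddleEstimates F M a b c A B k κ C ε r) (hρ0 : 0 < ρ)
    {p : ℂ × ℂ} (hp : ∀ n, F^[n] p ∈ Metric.ball (0 : ℂ × ℂ) r) (hp0 : p.1 ≠ 0) :
    ∃ n, (F^[n] p).1 ∈ petal a M (k / 2) ρ := by
  have hk := h.k_pos
  have hk4 := h.k_le
  have ha := h.norm_a_pos
  have hM := h.M_pos
  have hne : ∀ n, (F^[n] p).1 ≠ 0 := by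
    intro n
    induction n with
    | zero => exact hp0
    | succ n ih =>
      rw [Function.iterate_succ_apply']
      exact h.fst_ne_zero (hp n) ih
  have hev := eventually_mem_sector_of_drift (u := fun n => (petalCoord a M (F^[n] p).1)⁻¹)
    (ε := k / 8) (k := k / 2) (by nlinarith) (by linarith) (by linarith) (fun n => by
      have := (h.drift _ (hp n)).2 (hne n)
      rwa [← Function.iterate_succ_apply' F] at this) (‖a‖ * M * ρ ^ M)⁻¹
  obtain ⟨n, h1, h2⟩ := hev.exists
  refine ⟨n, by simpa using inv_mem_sector h1, ?_⟩
  have hxn : 0 < ‖(F^[n] p).1‖ := norm_pos_iff.2 (hne n)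
  have h3 := h2.trans_le (Complex.re_le_norm _)
  rw [norm_inv, norm_petalCoord, inv_lt_inv₀ (by positivity) (by positivity),
    mul_lt_mul_iff_right₀ (by positivity)] at h3
  exact lt_of_pow_lt_pow_left₀ M hρ0.le h3

theorem graph_mem_attractedSet (h : SaddleEstimates F M a b c A B k κ C ε r)
    (hκ : ∀ ζ w : ℂ, 0 < ζ.re → ‖w‖ < κ →
      (ζ * (1 + w) ^ M) ^ ((M : ℂ)⁻¹) = ζ ^ ((M : ℂ)⁻¹) * (1 + w))
    (hψ : IsInvariantGraph F a M c (k / 2) ε r ρ ψ) (hρ0 : 0 < ρ)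
    (hρ : ρ * (1 + graphSlope a c) ≤ s) (hsr : s ≤ r)
    (hsrc : Metric.ball (0 : ℂ × ℂ) s ⊆ F.source) {x : ℂ} (hx : x ∈ petal a M (k / 2) ρ) :
    (x, ψ x) ∈ attractedSet F (Metric.ball 0 s) := by
  obtain ⟨S, hS, hxS⟩ := h.exists_isParabolicCurve hκ hψ hρ0 (hρ.trans hsr)
    (fun x hx => hsrc (h.graph_mem_ball hψ hρ hx)) hx
  refine ⟨fun j => ?_, S, hS, 0, hxS⟩
  obtain ⟨h1, h2, -⟩ := h.iterate_graph hψ (hρ.trans hsr) hx j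
  have h3 := h.graph_mem_ball hψ hρ h1
  rwa [← h2] at h3

/-- A trapped orbit with `x ≠ 0` enters a petal, must then lie on the invariant graph, and so is on
a parabolic curve. -/
theorem mem_attractedSet_iff (h : SaddleEstimates F M a b c A B k κ C ε r)
    (hκ : ∀ ζ w : ℂ, 0 < ζ.re → ‖w‖ < κ →
      (ζ * (1 + w) ^ M) ^ ((M : ℂ)⁻¹) = ζ ^ ((M : ℂ)⁻¹) * (1 + w))
    (hψ : IsInvariantGraph F a M c (k / 2) ε r ρ ψ) (hρ0 : 0 < ρ)
    (hρ : ρ * (1 + graphSlope a c) ≤ s) (hsr : s ≤ r)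
    (hsrc : Metric.ball (0 : ℂ × ℂ) s ⊆ F.source) {p : ℂ × ℂ} (hp0 : p.1 ≠ 0) :
    p ∈ attractedSet F (Metric.ball 0 s) ↔ ∀ j, F^[j] p ∈ Metric.ball (0 : ℂ × ℂ) s := by
  refine ⟨fun hp => hp.1, fun hp => ?_⟩
  have hp' : ∀ j, F^[j] p ∈ Metric.ball (0 : ℂ × ℂ) r := fun j =>
    Metric.ball_subset_ball hsr (hp j)
  obtain ⟨n, hn⟩ := h.exists_iterate_mem_petal hρ0 hp' hp0
  have h1 := h.snd_eq_of_forall_iterate_mem (hρ.trans hsr) hψ.cone hψ.inv hψ.lip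
    (p := F^[n] p) (fun m => by rw [← Function.iterate_add_apply]; exact hp' _) hn
  obtain ⟨-, S, hS, j, hj⟩ := h.graph_mem_attractedSet hκ hψ hρ0 hρ hsr hsrc hn
  refine ⟨hp, S, hS, j + n, ?_⟩
  rw [← h1] at hj
  rwa [Function.iterate_add_apply]

theorem nonempty_petal (h : SaddleEstimates F M a b c A B k κ C ε r) (hρ0 : 0 < ρ) :
    (petal a M (k / 2) ρ).Nonempty := by
  have hk := h.k_pos
  have ha := h.norm_a_pos
  have hM := h.M_pos
  have hMC : (M : ℂ) ≠ 0 := by exact_mod_cast h.hM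
  set t := ‖a‖ * M * ρ ^ M / 2 with ht
  have ht0 : 0 < t := by positivity
  have e : petalCoord a M ((-(t / (a * M)) : ℂ) ^ ((M : ℂ)⁻¹)) = t := by
    have := h.ha
    rw [petalCoord, Complex.cpow_nat_inv_pow _ h.hM]
    field_simp
  refine ⟨(-(t / (a * M)) : ℂ) ^ ((M : ℂ)⁻¹), ?_, ?_⟩
  · rw [e]
    simp only [sector, mem_ofPred_eq, Complex.ofReal_im, Complex.ofReal_re, abs_zero]
    positivity
  · have h1 : ‖petalCoord a M ((-(t / (a * M)) : ℂ) ^ ((M : ℂ)⁻¹))‖ = t := by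
      rw [e, Complex.norm_real, Real.norm_of_nonneg ht0.le]
    rw [norm_petalCoord] at h1
    refine lt_of_pow_lt_pow_left₀ M hρ0.le ?_
    have h2 : 0 < ‖a‖ * M := by positivity
    have h3 : 0 < ‖a‖ * M * ρ ^ M := by positivity
    refine lt_of_mul_lt_mul_left ?_ h2.le
    rw [h1, ht]
    linarith

/-- Over the petals the attracted set is exactly the graph `y - ψ(x) = 0`, whose vertical derivative
is 1. Any other attracted point reaches this region after finitely many steps, and the local
equation is pulled back one step at a time. -/
theorem isOneDimSubmanifold_attractedSet (hF : IsBiholomorphismAtZero F)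
    (h : SaddleEstimates F M a b c A B k κ C ε r)
    (hκ : ∀ ζ w : ℂ, 0 < ζ.re → ‖w‖ < κ →
      (ζ * (1 + w) ^ M) ^ ((M : ℂ)⁻¹) = ζ ^ ((M : ℂ)⁻¹) * (1 + w))
    (hψ : IsInvariantGraph F a M c (k / 2) ε r ρ ψ) (hρ0 : 0 < ρ)
    (hρ : ρ * (1 + graphSlope a c) ≤ s) (hsr : s ≤ r)
    (hsrc : Metric.ball (0 : ℂ × ℂ) s ⊆ F.source) :
    IsOneDimSubmanifold (attractedSet F (Metric.ball 0 s)) (Metric.ball 0 s) := by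
  have hsub : Metric.ball (0 : ℂ × ℂ) s ⊆ Metric.ball 0 r := Metric.ball_subset_ball hsr
  refine ⟨fun p hp => hp.1 0, ?_, fun p hp => ?_⟩
  · obtain ⟨x, hx⟩ := h.nonempty_petal hρ0
    exact ⟨_, h.graph_mem_attractedSet hκ hψ hρ0 hρ hsr hsrc hx⟩
  have hp0 : p.1 ≠ 0 := by
    intro h0
    have hfix : F p = p := (h.apply_eq_self_iff (hsub (hp.1 0))).2 h0
    obtain ⟨-, S, hS, j, hj⟩ := hp
    rw [Function.iterate_fixed hfix] at hj
    exact hS.ne_of_mem hj hfix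
  obtain ⟨n, hn⟩ := h.exists_iterate_mem_petal hρ0 (fun n => hsub (hp.1 n)) hp0
  have hbase : IsCutOutAt (attractedSet F (Metric.ball 0 s)) (Metric.ball 0 s) (F^[n] p) := by
    have hopen := isOpen_petal a M (k / 2) ρ
    have hg : ∀ q : ℂ × ℂ, q.1 ∈ petal a M (k / 2) ρ →
        AnalyticAt ℂ (fun q : ℂ × ℂ => q.2 - ψ q.1) q := fun q hq =>
      analyticAt_snd.sub ((hψ.cone.1.analyticAt (hopen.mem_nhds hq)).fun_comp analyticAt_fst)
    refine ⟨Metric.ball 0 s ∩ Prod.fst ⁻¹' petal a M (k / 2) ρ, fun q => q.2 - ψ q.1,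
      Metric.isOpen_ball.inter (hopen.preimage continuous_fst), ⟨hp.1 n, hn⟩, inter_subset_left,
      fun q hq => hg q hq.2, fun q hq h0 => ?_, ?_⟩
    · have h1 := (hg q hq.2).differentiableAt.hasFDerivAt
      rw [h0] at h1
      have h2 : HasDerivAt (fun t : ℂ => (q.1, q.2 + t)) ((0 : ℂ), (1 : ℂ)) 0 :=
        (hasDerivAt_const _ _).prodMk ((hasDerivAt_id _).const_add _)
      have h3 : HasDerivAt (fun t : ℂ => (q.2 + t) - ψ q.1) 0 0 := by
        have := HasFDerivAt.comp_hasDerivAt (x := (0 : ℂ)) (f := fun t : ℂ => (q.1, q.2 + t))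
          (l := fun q : ℂ × ℂ => q.2 - ψ q.1) (by simpa using h1) h2
        rw [zero_apply] at this
        exact this
      have h4 : HasDerivAt (fun t : ℂ => (q.2 + t) - ψ q.1) 1 0 :=
        ((hasDerivAt_id _).const_add _).sub_const _
      exact zero_ne_one (h3.unique h4)
    · ext q
      constructor
      · rintro ⟨h1, h2⟩
        refine ⟨h2, sub_eq_zero.2 ?_⟩
        exact h.snd_eq_of_forall_iterate_mem (hρ.trans hsr) hψ.cone hψ.inv hψ.lip
          (fun n => hsub (h1.1 n)) h2.2
      · rintro ⟨h1, h2⟩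
        refine ⟨?_, h1⟩
        have h3 := h.graph_mem_attractedSet hκ hψ hρ0 hρ hsr hsrc h1.2
        rwa [← sub_eq_zero.1 h2] at h3
  have hback : ∀ m ≤ n, IsCutOutAt (attractedSet F (Metric.ball 0 s)) (Metric.ball 0 s)
      (F^[n - m] p) := by
    intro m hm
    induction m with
    | zero => exact hbase
    | succ m ih =>
      refine IsCutOutAt.of_apply hF Metric.isOpen_ball hsrc (hp.1 _) ?_
      rw [← Function.iterate_succ_apply' F, show (n - (m + 1)).succ = n - m by omega]
      exact ih (by omega)
  have := hback n le_rfl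
  rwa [Nat.sub_self] at this

end SaddleEstimates

/-! ### A common neighbourhood for the map and its inverse -/

/-- The attracted set depends on the ball, so the conclusion is needed for all small radii: one ball
must serve both `F` and its inverse. For each radius the same graph is restricted to a smaller
petal. -/
theorem IsNonCornerForm.exists_forall_ball {F : OpenPartialHomeomorph (ℂ × ℂ) (ℂ × ℂ)}
    (hF : IsBiholomorphismAtZero F) {M : ℕ} {a b c : ℂ} (h : IsNonCornerForm F M a b c)
    (hre : (b / a).re < 0) :
    ∃ r > 0, ∀ s, 0 < s → s ≤ r →
      Metric.ball (0 : ℂ × ℂ) s ⊆ F.source ∧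
      (∀ p ∈ Metric.ball (0 : ℂ × ℂ) s, F p = p ↔ p.1 = 0) ∧
      IsOneDimSubmanifold (attractedSet F (Metric.ball 0 s)) (Metric.ball 0 s) ∧
      ∀ p ∈ Metric.ball 0 s \ attractedSet F (Metric.ball 0 s), p.1 ≠ 0 →
        ∃ j : ℕ, F^[j] p ∉ Metric.ball (0 : ℂ × ℂ) s := by
  have hM : M ≠ 0 := Nat.one_le_iff_ne_zero.1 h.1
  obtain ⟨η, hη, hroot⟩ := exists_cpow_inv_mul M hM
  obtain ⟨A, B, k, κ, C, ε, r, hκη, hest⟩ := h.exists_saddleEstimates hre hη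
  have hκ : ∀ ζ w : ℂ, 0 < ζ.re → ‖w‖ < κ →
      (ζ * (1 + w) ^ M) ^ ((M : ℂ)⁻¹) = ζ ^ ((M : ℂ)⁻¹) * (1 + w) :=
    fun ζ w hζ hw => hroot ζ w hζ (hw.trans_le hκη)
  obtain ⟨ρ, hρ, ψ, hψ⟩ := hest.exists_isInvariantGraph
  obtain ⟨r', hr', hball⟩ := Metric.mem_nhds_iff.1 (F.open_source.mem_nhds hF.1)
  have hr := hest.r_pos
  have hk := hest.k_pos
  have hK := hest.graphSlope_pos
  refine ⟨min r r', by positivity, fun s hs hsr => ?_⟩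
  have hsr1 : s ≤ r := hsr.trans (min_le_left _ _)
  have hsrc : Metric.ball (0 : ℂ × ℂ) s ⊆ F.source :=
    (Metric.ball_subset_ball (hsr.trans (min_le_right _ _))).trans hball
  have hψ' := hψ.mono (ρ' := min ρ (s / (1 + graphSlope a c))) (by linarith) (min_le_left _ _)
  have hρ' : min ρ (s / (1 + graphSlope a c)) * (1 + graphSlope a c) ≤ s :=
    calc _ ≤ s / (1 + graphSlope a c) * (1 + graphSlope a c) := by
          gcongr; exact min_le_right _ _
      _ = s := by field_simp
  have hρ0 : 0 < min ρ (s / (1 + graphSlope a c)) := by positivity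
  refine ⟨hsrc, fun p hp => hest.apply_eq_self_iff (Metric.ball_subset_ball hsr1 hp),
    hest.isOneDimSubmanifold_attractedSet hF hκ hψ' hρ0 hρ' hsr1 hsrc, fun p hp hp0 => ?_⟩
  by_contra! hstay
  exact hp.2 ((hest.mem_attractedSet_iff hκ hψ' hρ0 hρ' hsr1 hsrc hp0).2 hstay)

theorem exists_nhd_of_isNonCornerForm {F : OpenPartialHomeomorph (ℂ × ℂ) (ℂ × ℂ)}
    (hF : IsBiholomorphismAtZero F) {M : ℕ} {a b c : ℂ} (h : IsNonCornerForm F M a b c)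
    (hre : (b / a).re < 0) :
    ∃ U : Set (ℂ × ℂ), IsOpen U ∧ (0 : ℂ × ℂ) ∈ U ∧ U ⊆ F.source ∩ F.target ∧
      (∀ p ∈ U, F p = p ↔ p.1 = 0) ∧
      IsOneDimSubmanifold (attractedSet F U) U ∧ IsOneDimSubmanifold (attractedSet F.symm U) U ∧
      (∀ p ∈ U \ attractedSet F U, F p ≠ p → ∃ j : ℕ, F^[j] p ∉ U) ∧
      (∀ p ∈ U \ attractedSet F.symm U, F p ≠ p → ∃ j : ℕ, F.symm^[j] p ∉ U) := by
  obtain ⟨r₁, hr₁, H₁⟩ := h.exists_forall_ball hF hre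
  obtain ⟨r₂, hr₂, H₂⟩ := (h.symm hF).exists_forall_ball hF.symm (by rwa [neg_div_neg_eq])
  obtain ⟨s1, f1, m1, e1⟩ := H₁ (min r₁ r₂) (by positivity) (min_le_left _ _)
  obtain ⟨s2, -, m2, e2⟩ := H₂ (min r₁ r₂) (by positivity) (min_le_right _ _)
  exact ⟨Metric.ball 0 (min r₁ r₂), Metric.isOpen_ball, Metric.mem_ball_self (by positivity),
    subset_inter s1 s2, f1, m1, m2, fun p hp hne => e1 p hp ((f1 p hp.1).not.1 hne),
    fun p hp hne => e2 p hp ((f1 p hp.1).not.1 hne)⟩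

end SaddleDynamics

theorem theoremB (F : OpenPartialHomeomorph (ℂ × ℂ) (ℂ × ℂ))
    (hF : SaddleDynamics.IsBiholomorphismAtZero F) :
    (∀ (M : ℕ) (a b c : ℂ), SaddleDynamics.IsNonCornerForm F M a b c → (b / a).re < 0 →
      ∃ U Pplus Pminus : Set (ℂ × ℂ),
        IsOpen U ∧ (0 : ℂ × ℂ) ∈ U ∧ U ⊆ F.source ∩ F.target ∧
        (∀ p ∈ U, F p = p ↔ p.1 = 0) ∧
        SaddleDynamics.IsOneDimSubmanifold Pplus U ∧
        SaddleDynamics.IsOneDimSubmanifold Pminus U ∧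
        Pplus = SaddleDynamics.attractedSet F U ∧
        Pminus = SaddleDynamics.attractedSet F.symm U ∧
        (∀ p ∈ U \ Pplus, F p ≠ p → ∃ j : ℕ, F^[j] p ∉ U) ∧
        (∀ p ∈ U \ Pminus, F p ≠ p → ∃ j : ℕ, F.symm^[j] p ∉ U)) ∧
    (∀ (M N : ℕ) (a b : ℂ), SaddleDynamics.IsCornerForm F M N a b →
      ((a / (a * M + b * N)).re < 0 ∨ (b / (a * M + b * N)).re < 0) →
      ∃ U : Set (ℂ × ℂ),
        IsOpen U ∧ (0 : ℂ × ℂ) ∈ U ∧ U ⊆ F.source ∩ F.target ∧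
        (∀ p ∈ U, F p = p ↔ p.1 * p.2 = 0) ∧
        (∀ p ∈ U, F p ≠ p → ∃ j : ℕ, F^[j] p ∉ U) ∧
        (∀ p ∈ U, F p ≠ p → ∃ j : ℕ, F.symm^[j] p ∉ U)) := by
  refine ⟨fun M a b c h hre => ?_, fun M N a b h hre =>
    SaddleDynamics.exists_nhd_escape_of_isCornerForm hF h hre⟩
  obtain ⟨U, h1, h2, h3, h4, h5, h6, h7, h8⟩ :=
    SaddleDynamics.exists_nhd_of_isNonCornerForm hF h hre
  exact ⟨U, _, _, h1, h2, h3, h4, h5, h6, rfl, rfl, h7, h8⟩
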